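/- **Proposition 5.3 (Wiman deletion).** Let $S=\mathbb{C}[x,y,z]$. For a reduced plane curve $C\subset\mathbb{P}^2_{\mathbb{C}}$ of degree $d$ with equation $f=0$, let $J_f=(f_x,f_y,f_z)$ be its Jacobian ideal and $M(f)=S/J_f$ its Milnor algebra. The curve $C$ is called *plus–one generated* with exponents $(d_1,d_2,d_3)$, where $1\le d_1\le d_2\le d_3$, if $M(f)$ has a minimal graded free resolution of the form $$0\to S(-e)\to\bigoplus_{i=1}^{3}S(1-d-d_i)\to S(1-d)^3\to S\to M(f)\to 0$$ for some integer $e$, and $d_1+d_2=d$. A finite arrangement of lines is plus–one generated if the union of its lines is, as a reduced curve whose degree is the number of lines. Let $\mathcal{W}\subset\mathbb{P}^2_{\mathbb{C}}$ be the Wiman arrangement, that is, the reflection arrangement of the Shephard–Todd group $G_{27}$: the set of mirrors (viewed as lines in $\mathbb{P}^2_{\mathbb{C}}$) of all reflections in the subgroup of $\mathrm{GL}_3(\mathbb{C})$ generated by the three unitary reflections of order two with roots $(1,0,0)$, $(\tau^{-1},1,\tau)$ and $(1,\omega\tau^{-1},\omega^2\tau)$, where $\tau=\frac{1+\sqrt5}{2}$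 and $\omega=\frac{-1+i\sqrt3}{2}$. Then $\mathcal{W}$ consists of $45$ lines, and for every line $\ell\in\mathcal{W}$ the arrangement $\mathcal{W}'=\mathcal{W}\setminus\{\ell\}$ is plus–one generated with exponents $(19,25,28)$. -/

import Mathlib

namespace WimanDeletion

open MvPolynomial

/-- The graded polynomial ring `S = ℂ[x, y, z]`. -/
abbrev S : Type := MvPolynomial (Fin 3) ℂ

/-- The Jacobian ideal `J_f`, generated by the three partial derivatives of `f`. -/
noncomputable def jacobianIdeal (f : S) : Ideal S :=
  Ideal.span (Set.range fun i : Fin 3 => pderiv i f)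

/-- `f = 0` is a reduced curve of degree `d` in the complex projective plane. -/
structure IsReducedCurve (f : S) (d : ℕ) : Prop where
  pos : 0 < d
  homogeneous : f.IsHomogeneous d
  squarefree : Squarefree f

/-- The matrix `A` describes a homomorphism of graded modules (of degree zero)
`⨁_j S(-b j) → ⨁_i S(-a i)`, `ε_j ↦ ∑_i A i j ε_i`: the entry at `(i, j)` lies in
`S_{b j - a i}`, so it is zero when `b j < a i`. -/
def IsGradedMatrix {ι κ : Type} (A : Matrix ι κ S) (a : ι → ℕ) (b : κ → ℕ) : Prop :=
  ∀ i j, A i j = 0 ∨ ∃ n : ℕ, b j = a i + n ∧ (A i j).IsHomogeneous n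

/-- All entries lie in the irrelevant ideal `(x, y, z)`: the minimality condition. -/
def IsMinimalMatrix {ι κ : Type} (A : Matrix ι κ S) : Prop :=
  ∀ i j, constantCoeff (A i j) = 0

/-- The reduced curve `f = 0` of degree `d` is an `m`-syzygy curve, `m = k + 2`, with exponents
`ds 0 ≤ ⋯ ≤ ds (m - 1)`: its Milnor algebra `M(f) = S / J_f` has a minimal graded free resolution
`0 → ⨁_{i < k} S(-e i) → ⨁_{i < k + 2} S(1 - d - ds i) → S(1 - d)³ → S → M(f) → 0`.
The three maps of free modules are `φ₃`, `φ₂` and `φ₁`; the map `φ₁` has a single row, and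
exactness at `S` says that its image is `J_f`. -/
def IsSyzygyCurve (f : S) (d : ℕ) {k : ℕ} (ds : Fin (k + 2) → ℕ) : Prop :=
  IsReducedCurve f d ∧ (∀ i, 1 ≤ ds i) ∧ Monotone ds ∧
  ∃ (e : Fin k → ℕ) (φ₁ : Fin 3 → S) (φ₂ : Matrix (Fin 3) (Fin (k + 2)) S)
    (φ₃ : Matrix (Fin (k + 2)) (Fin k) S),
    Monotone e ∧
    -- the maps are graded of degree zero
    (∀ i, (φ₁ i).IsHomogeneous (d - 1)) ∧
    IsGradedMatrix φ₂ (fun _ => d - 1) (fun i => d - 1 + ds i) ∧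
    IsGradedMatrix φ₃ (fun i => d - 1 + ds i) e ∧
    -- the resolution is minimal
    (∀ i, constantCoeff (φ₁ i) = 0) ∧ IsMinimalMatrix φ₂ ∧ IsMinimalMatrix φ₃ ∧
    -- the sequence is exact
    Function.Injective φ₃.mulVecLin ∧
    Function.Exact φ₃.mulVecLin φ₂.mulVecLin ∧
    Function.Exact φ₂.mulVecLin (Fintype.linearCombination S φ₁) ∧
    LinearMap.range (Fintype.linearCombination S φ₁) = jacobianIdeal f

/-- The reduced curve `f = 0` of degree `d` is plus-one generated with exponents `(d₁, d₂, d₃)`: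
it is a `3`-syzygy curve with these exponents and `d₁ + d₂ = d`. -/
def IsPlusOneGeneratedCurve (f : S) (d d₁ d₂ d₃ : ℕ) : Prop :=
  IsSyzygyCurve f d (k := 1) ![d₁, d₂, d₃] ∧ d₁ + d₂ = d

/-- A line in the projective plane, given by its coefficient vector `(a, b, c) ≠ 0` up to scaling:
the line `a x + b y + c z = 0`. -/
abbrev ProjLine : Type := Projectivization ℂ (Fin 3 → ℂ)

/-- An equation `a x + b y + c z` of a line (unique up to a nonzero constant). -/
noncomputable def lineForm (ℓ : ProjLine) : S :=
  ∑ i : Fin 3, C (ℓ.rep i) * X i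

/-- The line arrangement `A` is finite, and the curve that is the union of its lines, defined by the
product of their equations and of degree `|A|`, is plus-one generated with exponents
`(d₁, d₂, d₃)`. -/
def IsPlusOneGenerated (A : Set ProjLine) (d₁ d₂ d₃ : ℕ) : Prop :=
  A.Finite ∧ IsPlusOneGeneratedCurve (∏ᶠ ℓ ∈ A, lineForm ℓ) A.ncard d₁ d₂ d₃

/-- The matrix of the unitary reflection of order two with root `a ≠ 0`, that is,
`x ↦ x - 2 (⟨a, x⟩ / ⟨a, a⟩) a` for the standard Hermitian form on `ℂ³`. -/
noncomputable def reflectionMatrix (a : Fin 3 → ℂ) : Matrix (Fin 3) (Fin 3) ℂ :=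
  1 - (2 / (star a ⬝ᵥ a)) • Matrix.vecMulVec a (star a)

/-- The golden ratio `τ = (1 + √5) / 2`, as a complex number. -/
noncomputable def τ : ℂ := (1 + (Real.sqrt 5 : ℂ)) / 2

/-- The primitive cube root of unity `ω = (-1 + i √3) / 2`. -/
noncomputable def ω : ℂ := (-1 + (Real.sqrt 3 : ℂ) * Complex.I) / 2

/-- Three roots generating the line system `J₃(5)`: `(1, 0, 0)`, `(τ⁻¹, 1, τ)` and
`(1, ω τ⁻¹, ω² τ)`. -/
noncomputable def wimanRoot : Fin 3 → Fin 3 → ℂ :=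
  ![![1, 0, 0], ![τ⁻¹, 1, τ], ![1, ω * τ⁻¹, ω ^ 2 * τ]]

/-- The Shephard–Todd complex reflection group `G₂₇`, of order 2160, generated by the reflections in
the three roots. Modulo its centre, of order 6, it is the Valentiner group in `PGL₃(ℂ)`, which is
isomorphic to the alternating group `A₆`. -/
noncomputable def wimanGroup : Subgroup (GL (Fin 3) ℂ) :=
  Subgroup.closure {g | ∃ i, (g : Matrix (Fin 3) (Fin 3) ℂ) = reflectionMatrix (wimanRoot i)}

/-- The Wiman arrangement: the reflection arrangement of `G₂₇`. Its lines are the mirrors of the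
reflections in the group, that is, the planes in `ℂ³` (lines in the projective plane) that are
fixed pointwise by a nontrivial element of the group. -/
noncomputable def wimanArrangement : Set ProjLine :=
  {ℓ | ∃ g ∈ wimanGroup, g ≠ 1 ∧
    ∀ x : Fin 3 → ℂ, ℓ.rep ⬝ᵥ x = 0 → (g : Matrix (Fin 3) (Fin 3) ℂ).mulVec x = x}

end WimanDeletion

/-! The Wiman arrangement is free with exponents (1, 19, 25), and each of its lines carries 16
intersection points. Deleting a line of a free arrangement keeps the two nontrivial exponents and
adds one generator, of degree 44 - 16 = 28.

Freeness. Let F be the sum of the sixth powers of the 45 mirror equations, and H its Hessian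
determinant, of degree 12. Both are invariants, so the vector fields adj(Hess F)∇H and adj(Hess
H)∇F, of degrees 19 and 25, are equivariant and hence tangent to every mirror
(`hessField_equivariant`, `tangent_of_equivariant`). Their determinant with the Euler field has
degree 1 + 19 + 25 = 45 and is divisible by every mirror equation. Exact evaluation at one point
over ℤ[τ, ω] shows that it is nonzero, so it is a constant times the product of the 45 equations:
this is Saito's criterion (`exists_jacobian_eq`). The same divisibility excludes further mirrors, so
the group is never enumerated (`wimanArrangement_eq`).

Deletion (`isPlusOneGeneratedCurve_deletion`). Let α be the equation of the deleted line, f that of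
the remaining lines. Modulo Euler multiples the two basic fields kill α. On the line they and the
Euler field lie in a module of rank two, so Cramer's rule gives a relation. Its coefficients are
divisible by the product of the equations of the n points on the line; after division, b₂θ₁ - b₁θ₂ +
γX vanishes on the line, and dividing by α yields a third field φ, of degree d - n. Projected to the
syzygies of ∇f, this reads αφ = b₂ρ₁ - b₁ρ₂ with ρ₁ ⨯₃ ρ₂ a multiple of α∇f. Coprimality of b₁ and
b₂ (`isRelPrime_of_relation`) then makes ρ₁, ρ₂, φ generators with this single relation, which is
the required resolution (`isPlusOneGeneratedCurve_of_relation`). -/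

namespace WimanDeletion

open MvPolynomial Matrix

/-! ### Cross product identities over a commutative ring -/

section CrossProduct

variable {R : Type*} [CommRing R]

theorem dot_expand (u v : Fin 3 → R) : u ⬝ᵥ v = u 0 * v 0 + u 1 * v 1 + u 2 * v 2 :=
  vec3_dotProduct u v

/-- Cramer's rule, one coordinate at a time. With vanishing determinant it becomes a linear relation
between the three vectors. -/
theorem cramer_cross (x y z : Fin 3 → R) (k : Fin 3) :
    (y ⨯₃ z) k • x + (z ⨯₃ x) k • y + (x ⨯₃ y) k • z = Pi.single k (x ⬝ᵥ y ⨯₃ z) := by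
  ext i
  rw [dot_expand]
  fin_cases k <;> fin_cases i <;> simp [cross_apply] <;> ring

theorem triple_smul (v x y z : Fin 3 → R) :
    (x ⬝ᵥ y ⨯₃ z) • v = (v ⬝ᵥ x) • (y ⨯₃ z) + (v ⬝ᵥ y) • (z ⨯₃ x) + (v ⬝ᵥ z) • (x ⨯₃ y) := by
  simp only [dot_expand]
  ext i
  fin_cases i <;> simp [cross_apply] <;> ring

/-- A vector whose cross product with `a` vanishes is proportional to `a`. -/
theorem smul_eq_of_cross_eq_zero {a v : Fin 3 → R} (h : a ⨯₃ v = 0) (w : Fin 3 → R) :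
    (w ⬝ᵥ a) • v = (w ⬝ᵥ v) • a := by
  have := cross_cross_eq_smul_sub_smul' w a v
  rw [h, map_zero, dotProduct_comm a w] at this
  exact (sub_eq_zero.1 (by rw [← this])).symm

theorem map_cross {R' : Type*} [CommRing R'] (g : R →+* R') (u v : Fin 3 → R) (i : Fin 3) :
    g ((u ⨯₃ v) i) = ((fun j => g (u j)) ⨯₃ fun j => g (v j)) i := by
  fin_cases i <;> simp [cross_apply]

theorem map_dot {R' : Type*} [CommRing R'] (g : R →+* R') (u v : Fin 3 → R) :
    g (u ⬝ᵥ v) = (fun j => g (u j)) ⬝ᵥ fun j => g (v j) := by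
  simp [dot_expand]

end CrossProduct

/-! ### Linear forms and the lines they define -/

section LinearForms

/-- A vector of constants. -/
noncomputable def cvec (v : Fin 3 → ℂ) : Fin 3 → S := fun i => C (v i)

/-- The linear form with coefficient vector `v`. -/
noncomputable def lin (v : Fin 3 → ℂ) : S := ∑ i : Fin 3, C (v i) * X i

theorem eval_lin (v x : Fin 3 → ℂ) : eval x (lin v) = v ⬝ᵥ x := by
  simp [lin, dotProduct]

theorem isHomogeneous_lin (v : Fin 3 → ℂ) : (lin v).IsHomogeneous 1 :=
  IsHomogeneous.sum _ _ _ fun i _ => isHomogeneous_C_mul_X _ i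

theorem lin_smul (c : ℂ) (v : Fin 3 → ℂ) : lin (c • v) = C c * lin v := by
  simp [lin, Finset.mul_sum, mul_assoc]

theorem pderiv_lin (v : Fin 3 → ℂ) (i : Fin 3) : pderiv i (lin v) = C (v i) := by
  classical
  simp [lin, pderiv_X, Pi.single_apply]

theorem lin_ne_zero {v : Fin 3 → ℂ} (hv : v ≠ 0) : lin v ≠ 0 := by
  intro h
  apply hv
  ext i
  have := pderiv_lin v i
  rw [h, map_zero] at this
  exact (C_injective _ _ (this.symm.trans (C_0).symm))

theorem prime_lin {v : Fin 3 → ℂ} (hv : v ≠ 0) : Prime (lin v) := by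
  rw [← UniqueFactorizationMonoid.irreducible_iff_prime]
  refine irreducible_of_totalDegree_eq_one ((isHomogeneous_lin v).totalDegree (lin_ne_zero hv)) ?_
  intro c hc
  obtain ⟨i, hi⟩ := Function.ne_iff.1 hv
  obtain ⟨d, hd⟩ : ∃ d, coeff d (lin v) ≠ 0 := by
    by_contra h
    push Not at h
    exact lin_ne_zero hv (MvPolynomial.ext _ _ (by simpa using h))
  exact (isUnit_iff_ne_zero.2 fun h0 => hd (by simpa [h0] using hc d))

/-- The points `v ⨯₃ e_i` lie on the line of `v`, hence on that of `w`; pairing them with `w` gives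
the coordinates of the cross product up to sign. -/
theorem proportional_of_lin_dvd {v w : Fin 3 → ℂ} (h : lin v ∣ lin w) : v ⨯₃ w = 0 := by
  obtain ⟨q, hq⟩ := h
  have key : ∀ x : Fin 3 → ℂ, v ⬝ᵥ x = 0 → w ⬝ᵥ x = 0 := by
    intro x hx
    rw [← eval_lin, hq, map_mul, eval_lin, hx, zero_mul]
  ext i
  have h0 := key (v ⨯₃ Pi.single i 1) (dot_self_cross _ _)
  rw [triple_product_permutation, triple_product_permutation] at h0
  have : (w ⨯₃ v) i = 0 := by simpa using h0
  rw [← cross_anticomm, Pi.neg_apply, this]; simp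

theorem isRelPrime_lin {v w : Fin 3 → ℂ} (h : v ⨯₃ w ≠ 0) : IsRelPrime (lin v) (lin w) := by
  have hv : v ≠ 0 := by rintro rfl; simp at h
  exact ((prime_lin hv).irreducible.isRelPrime_iff_not_dvd).2
    fun hd => h (proportional_of_lin_dvd hd)

theorem isUnit_cvec {v : Fin 3 → ℂ} {i : Fin 3} (h : v i ≠ 0) : IsUnit (cvec v i) := by
  simpa [cvec] using h

theorem cvec_cross (v w : Fin 3 → ℂ) : cvec v ⨯₃ cvec w = cvec (v ⨯₃ w) := by
  ext1 i
  exact (map_cross C v w i).symm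

/-- If a polynomial divides all multiples of a polynomial by the entries of a nonzero
constant vector, it divides the polynomial. -/
theorem dvd_of_dvd_smul_cvec {v : Fin 3 → ℂ} (hv : v ≠ 0) {p q : S}
    (h : ∀ i, p ∣ (q • cvec v) i) : p ∣ q := by
  obtain ⟨i, hi⟩ := Function.ne_iff.1 hv
  obtain ⟨u, hu⟩ := isUnit_cvec (v := v) (i := i) hi
  have := h i
  rw [Pi.smul_apply, smul_eq_mul, ← hu] at this
  exact (Units.dvd_mul_right).1 this

theorem smul_cvec_cancel {v : Fin 3 → ℂ} (hv : v ≠ 0) {p q : S}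
    (h : p • cvec v = q • cvec v) : p = q := by
  obtain ⟨i, hi⟩ := Function.ne_iff.1 hv
  have := congrFun h i
  simp only [Pi.smul_apply, smul_eq_mul] at this
  exact (isUnit_cvec (v := v) (i := i) hi).mul_right_cancel this

end LinearForms

/-! ### Degrees of products and cofactors -/

section Homogeneous

theorem isHomogeneous_dot {u v : Fin 3 → S} {m n : ℕ} (hu : ∀ i, (u i).IsHomogeneous m)
    (hv : ∀ i, (v i).IsHomogeneous n) : (u ⬝ᵥ v).IsHomogeneous (m + n) :=
  IsHomogeneous.sum _ _ _ fun i _ => (hu i).mul (hv i)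

theorem isHomogeneous_cross {u v : Fin 3 → S} {m n : ℕ} (hu : ∀ i, (u i).IsHomogeneous m)
    (hv : ∀ i, (v i).IsHomogeneous n) (i : Fin 3) : ((u ⨯₃ v) i).IsHomogeneous (m + n) := by
  fin_cases i <;> simp only [cross_apply] <;> exact ((hu _).mul (hv _)).sub ((hu _).mul (hv _))

/-- A cofactor of a homogeneous polynomial in a homogeneous polynomial is homogeneous. -/
theorem isHomogeneous_of_mul {p q : S} {m n : ℕ} (hp : p.IsHomogeneous m) (hp0 : p ≠ 0)
    (h : (p * q).IsHomogeneous (m + n)) : q.IsHomogeneous n := by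
  have key : p * homogeneousComponent n q = p * q := by
    have h1 : homogeneousComponent (m + n) (p * q) = p * q := homogeneousComponent_eq_self h
    have h2 : homogeneousComponent (m + n) (p * q) = p * homogeneousComponent n q := by
      conv_lhs => rw [← sum_homogeneousComponent q, Finset.mul_sum, map_sum]
      have h3 : ∀ i, homogeneousComponent (m + n) (p * homogeneousComponent i q)
          = if i = n then p * homogeneousComponent n q else 0 := by
        intro i
        rw [homogeneousComponent_of_mem (hp.mul (homogeneousComponent_isHomogeneous i q))]
        by_cases hi : i = n
        · simp [hi]
        · simp [hi, Ne.symm hi]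
      simp only [h3, Finset.sum_ite_eq', Finset.mem_range]
      split_ifs with hn
      · rfl
      · rw [homogeneousComponent_eq_zero _ _ (by omega), mul_zero]
    rw [← h2, h1]
  rw [← mul_left_cancel₀ hp0 key]
  exact homogeneousComponent_isHomogeneous n q

end Homogeneous

/-! ### Gradients and logarithmic vector fields -/

section Gradient

/-- The gradient of a polynomial. -/
noncomputable def grad (f : S) : Fin 3 → S := fun i => pderiv i f

theorem grad_mul (f g : S) : grad (f * g) = f • grad g + g • grad f := by
  ext1 i
  simp [grad, Derivation.leibniz]

theorem grad_lin (v : Fin 3 → ℂ) : grad (lin v) = cvec v := by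
  ext1 i
  exact pderiv_lin v i

theorem isHomogeneous_grad {f : S} {d : ℕ} (hf : f.IsHomogeneous d) (i : Fin 3) :
    (grad f i).IsHomogeneous (d - 1) := hf.pderiv

theorem dot_X_grad {f : S} {d : ℕ} (hf : f.IsHomogeneous d) :
    (X : Fin 3 → S) ⬝ᵥ grad f = C (d : ℂ) * f := by
  have := hf.sum_X_mul_pderiv
  rw [nsmul_eq_mul] at this
  simpa [grad, dotProduct] using this

variable {ι : Type*} {v : ι → Fin 3 → ℂ}

theorem dot_X_cvec (w : Fin 3 → ℂ) : cvec w ⬝ᵥ X = lin w := rfl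

/-- A vector field tangent to all lines of an arrangement is tangent to their union. -/
theorem prod_dvd_dot_grad {s : Finset ι} {η : Fin 3 → S}
    (h : ∀ j ∈ s, lin (v j) ∣ cvec (v j) ⬝ᵥ η) :
    ∏ j ∈ s, lin (v j) ∣ η ⬝ᵥ grad (∏ j ∈ s, lin (v j)) := by
  classical
  induction s using Finset.induction_on with
  | empty =>
    simp
  | insert j s hj ih =>
    rw [Finset.prod_insert hj, grad_mul, dotProduct_add, dotProduct_smul, dotProduct_smul, grad_lin]
    refine dvd_add ?_ ?_
    · exact mul_dvd_mul_left _ (ih fun i hi => h i (Finset.mem_insert_of_mem hi))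
    · obtain ⟨q, hq⟩ := h j (Finset.mem_insert_self _ _)
      exact ⟨q, by rw [dotProduct_comm, hq, smul_eq_mul]; ring⟩

theorem pairwise_isRelPrime_lin (hv : ∀ i j, i ≠ j → v i ⨯₃ v j ≠ 0) (s : Finset ι) :
    (s : Set ι).Pairwise (Function.onFun IsRelPrime fun j => lin (v j)) :=
  fun i _ j _ hij => isRelPrime_lin (hv i j hij)

theorem squarefree_prod_lin (hv : ∀ i j, i ≠ j → v i ⨯₃ v j ≠ 0) (hv0 : ∀ i, v i ≠ 0)
    (s : Finset ι) : Squarefree (∏ j ∈ s, lin (v j)) :=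
  Finset.squarefree_prod_of_pairwise_isCoprime (pairwise_isRelPrime_lin hv s)
    fun i _ => (prime_lin (hv0 i)).irreducible.squarefree

/-- A vector field annihilating the equation of an arrangement is tangent to its lines. -/
theorem tangent_of_dot_grad_eq_zero (hv : ∀ i j, i ≠ j → v i ⨯₃ v j ≠ 0) {s : Finset ι}
    {η : Fin 3 → S} (h : η ⬝ᵥ grad (∏ j ∈ s, lin (v j)) = 0) {j : ι} (hj : j ∈ s) :
    lin (v j) ∣ cvec (v j) ⬝ᵥ η := by
  classical
  rw [← Finset.mul_prod_erase s _ hj, grad_mul, dotProduct_add, dotProduct_smul, dotProduct_smul,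
    grad_lin, smul_eq_mul, smul_eq_mul] at h
  have hrel : IsRelPrime (lin (v j)) (∏ i ∈ s.erase j, lin (v i)) :=
    IsRelPrime.prod_right fun i hi => isRelPrime_lin (hv _ _ (Finset.ne_of_mem_erase hi).symm)
  refine hrel.dvd_of_dvd_mul_left ?_
  rw [dotProduct_comm, eq_neg_of_add_eq_zero_right h]
  exact (dvd_mul_right _ _).neg_right

/-- By `triple_smul`, the determinant times the constant vector `w` is a combination of the three
pairings with `w`; some entry of `w` is a unit. -/
theorem dvd_triple_of_tangent {w : Fin 3 → ℂ} (hw : w ≠ 0) {x y z : Fin 3 → S}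
    (hx : lin w ∣ cvec w ⬝ᵥ x) (hy : lin w ∣ cvec w ⬝ᵥ y) (hz : lin w ∣ cvec w ⬝ᵥ z) :
    lin w ∣ x ⬝ᵥ y ⨯₃ z := by
  refine dvd_of_dvd_smul_cvec hw fun i => ?_
  rw [triple_smul]
  simp only [Pi.add_apply, Pi.smul_apply, smul_eq_mul]
  exact dvd_add (dvd_add (hx.mul_right _) (hy.mul_right _)) (hz.mul_right _)

theorem tangent_X (w : Fin 3 → ℂ) : lin w ∣ cvec w ⬝ᵥ (X : Fin 3 → S) := by
  rw [dot_X_cvec]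

/-- Two vectors orthogonal to the gradient of the equation of an arrangement have cross product
a multiple of this gradient. -/
theorem exists_cross_eq_smul_grad (hv : ∀ i j, i ≠ j → v i ⨯₃ v j ≠ 0) (hv0 : ∀ i, v i ≠ 0)
    {s : Finset ι} {d : ℕ} (hd : d ≠ 0) (hf : (∏ j ∈ s, lin (v j)).IsHomogeneous d)
    {η ρ : Fin 3 → S} (hη : η ⬝ᵥ grad (∏ j ∈ s, lin (v j)) = 0)
    (hρ : ρ ⬝ᵥ grad (∏ j ∈ s, lin (v j)) = 0) :
    ∃ u : S, η ⨯₃ ρ = u • grad (∏ j ∈ s, lin (v j)) := by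
  set f := ∏ j ∈ s, lin (v j) with hfdef
  have hf0 : f ≠ 0 := Finset.prod_ne_zero_iff.2 fun j _ => lin_ne_zero (hv0 j)
  obtain ⟨u, hu⟩ : f ∣ X ⬝ᵥ η ⨯₃ ρ :=
    Finset.prod_dvd_of_isRelPrime (pairwise_isRelPrime_lin hv s) fun j hj =>
      dvd_triple_of_tangent (hv0 j) (tangent_X _) (tangent_of_dot_grad_eq_zero hv hη hj)
        (tangent_of_dot_grad_eq_zero hv hρ hj)
  have hcr : grad f ⨯₃ (η ⨯₃ ρ) = 0 := by
    rw [cross_cross_eq_smul_sub_smul', dotProduct_comm, hρ, hη]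
    simp
  -- The cross product is parallel to the gradient; Euler's formula turns this into `d f (η ⨯₃ ρ) =
  -- f u ∇f`, where `f` cancels.
  have h1 := smul_eq_of_cross_eq_zero hcr X
  rw [dot_X_grad hf, hu] at h1
  refine ⟨C (d : ℂ)⁻¹ * u, ?_⟩
  ext1 i
  have h2 := congrFun h1 i
  simp only [Pi.smul_apply, smul_eq_mul] at h2 ⊢
  have hC : (C (d : ℂ) : S) * C (d : ℂ)⁻¹ = 1 := by
    rw [← C_mul, mul_inv_cancel₀ (by exact_mod_cast hd), C_1]
  have h3 : C (d : ℂ) * (η ⨯₃ ρ) i = u * grad f i := by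
    apply mul_left_cancel₀ hf0
    linear_combination h2
  linear_combination (-(η ⨯₃ ρ) i) * hC + C (d : ℂ)⁻¹ * h3

/-- Subtracting a multiple of the Euler field from a vector field tangent to the arrangement gives a
field annihilating its equation. -/
theorem exists_sub_smul_X_dot_grad (s : Finset ι) {d : ℕ} (hd : d ≠ 0)
    (hf : (∏ j ∈ s, lin (v j)).IsHomogeneous d) (hv0 : ∀ i, v i ≠ 0)
    {η : Fin 3 → S} (h : ∀ j ∈ s, lin (v j) ∣ cvec (v j) ⬝ᵥ η) {e : ℕ}
    (hη : ∀ i, (η i).IsHomogeneous (e + 1)) :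
    ∃ g : S, (η - g • X) ⬝ᵥ grad (∏ j ∈ s, lin (v j)) = 0 ∧
      ∀ i, ((η - g • (X : Fin 3 → S)) i).IsHomogeneous (e + 1) := by
  obtain ⟨q, hq⟩ := prod_dvd_dot_grad h
  set f := ∏ j ∈ s, lin (v j) with hfdef
  have hf0 : f ≠ 0 := Finset.prod_ne_zero_iff.2 fun j _ => lin_ne_zero (hv0 j)
  have hC : (C (d : ℂ) : S) * C (d : ℂ)⁻¹ = 1 := by
    rw [← C_mul, mul_inv_cancel₀ (by exact_mod_cast hd), C_1]
  have hqh : q.IsHomogeneous e := by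
    refine isHomogeneous_of_mul hf hf0 ?_
    rw [← hq]
    have := isHomogeneous_dot hη (isHomogeneous_grad hf)
    rwa [show e + 1 + (d - 1) = d + e by omega] at this
  -- The field sends `f` to `q f` and the Euler field sends it to `d f`, hence the coefficient `q /
  -- d`.
  refine ⟨C (d : ℂ)⁻¹ * q, ?_, fun i => ?_⟩
  · rw [sub_dotProduct, smul_dotProduct, dot_X_grad hf, hq, smul_eq_mul]
    linear_combination (- f * q) * hC
  · refine (hη i).sub ?_
    exact (hqh.C_mul _).mul (isHomogeneous_X _ i)

end Gradient

/-! ### Restriction to a line, realised inside the polynomial ring -/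

section Retraction

/-- The substitution that eliminates the variable `X k` by means of the equation `lin a = 0`,
where `a k ≠ 0`. -/
noncomputable def retract (a : Fin 3 → ℂ) (k : Fin 3) : S →ₐ[ℂ] S :=
  aeval fun i => X i - C (Pi.single (M := fun _ => ℂ) k (a k)⁻¹ i) * lin a

variable {a : Fin 3 → ℂ} {k : Fin 3}

theorem retract_C (c : ℂ) : retract a k (C c) = C c := by
  simp [retract, algebraMap_eq]

theorem retract_X_of_ne {i : Fin 3} (h : i ≠ k) : retract a k (X i) = X i := by
  simp [retract, h]

theorem dvd_sub_retract (p : S) : lin a ∣ p - retract a k p := by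
  induction p using MvPolynomial.induction_on with
  | C c => simp
  | add p q hp hq =>
    rw [map_add, add_sub_add_comm]
    exact dvd_add hp hq
  | mul_X p i hp =>
    rw [map_mul, retract, aeval_X, ← retract]
    have : p * X i - retract a k p * (X i - C (Pi.single (M := fun _ => ℂ) k (a k)⁻¹ i) * lin a)
      = (p - retract a k p) * X i +
        lin a * (retract a k p * C (Pi.single (M := fun _ => ℂ) k (a k)⁻¹ i)) := by ring
    rw [this]
    exact dvd_add (hp.mul_right _) (dvd_mul_right _ _)

theorem retract_lin (w : Fin 3 → ℂ) :
    retract a k (lin w) = lin (w - (w k / a k) • a) := by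
  have h1 : lin (w - (w k / a k) • a) = lin w - C (w k / a k) * lin a := by
    rw [← lin_smul]
    simp [lin, sub_mul]
  have h2 : retract a k (lin w) =
      ∑ i, C (w i) * (X i - C (Pi.single (M := fun _ => ℂ) k (a k)⁻¹ i) * lin a) := by
    simp [lin, retract, algebraMap_eq]
  rw [h1, h2]
  simp only [mul_sub, Finset.sum_sub_distrib]
  congr 1
  rw [Finset.sum_eq_single k (fun i _ hi => by simp [hi]) (by simp)]
  rw [Pi.single_eq_same, ← mul_assoc, ← C_mul, div_eq_mul_inv]

theorem retract_lin_self (ha : a k ≠ 0) : retract a k (lin a) = 0 := by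
  rw [retract_lin, div_self ha]; simp [lin]

/-- The image of the retraction models the quotient by `lin a`, so congruences modulo the line
become equalities in `S`. -/
theorem retract_eq_zero_iff (ha : a k ≠ 0) (p : S) : retract a k p = 0 ↔ lin a ∣ p := by
  constructor
  · intro h
    have := dvd_sub_retract (a := a) (k := k) p
    rwa [h, sub_zero] at this
  · rintro ⟨q, rfl⟩
    rw [map_mul, retract_lin_self ha, zero_mul]

theorem retract_retract (ha : a k ≠ 0) (p : S) :
    retract a k (retract a k p) = retract a k p := by
  have := (retract_eq_zero_iff ha _).2 (dvd_sub_retract (a := a) (k := k) p)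
  rw [map_sub] at this
  exact (sub_eq_zero.1 this).symm

theorem isHomogeneous_retract {p : S} {n : ℕ} (hp : p.IsHomogeneous n) :
    (retract a k p).IsHomogeneous n := by
  have := hp.aeval (fun i => X i - C (Pi.single (M := fun _ => ℂ) k (a k)⁻¹ i) * lin a) (n := 1)
    fun i => (isHomogeneous_X _ i).sub ((isHomogeneous_lin a).C_mul _)
  simpa [retract] using this

end Retraction

/-! ### The resolution from two syzygies and one relation -/

section Resolution

theorem constantCoeff_eq_zero_of_isHomogeneous {p : S} {n : ℕ} (hp : p.IsHomogeneous n)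
    (hn : 0 < n) : constantCoeff p = 0 := by
  rw [constantCoeff_eq]
  exact hp.coeff_eq_zero (by simpa using hn.ne)

theorem not_isUnit_of_isHomogeneous {p : S} {n : ℕ} (hp : p.IsHomogeneous n) (hn : 0 < n) :
    ¬ IsUnit p := fun h => by
  have := h.map (constantCoeff (R := ℂ) (σ := Fin 3))
  rw [constantCoeff_eq_zero_of_isHomogeneous hp hn] at this
  exact not_isUnit_zero this

variable {ι : Type*} {v : ι → Fin 3 → ℂ} {s : Finset ι} {a : Fin 3 → ℂ} {k : Fin 3}
  {d n₁ n₂ : ℕ} {κ : ℂ} {ρ₁ ρ₂ φ : Fin 3 → S} {b₁ b₂ : S}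

theorem ne_zero_of_isRelPrime (hb : IsRelPrime b₁ b₂) (hn : 0 < n₂) (h : b₂.IsHomogeneous n₂) :
    b₁ ≠ 0 := by
  rintro rfl
  exact not_isUnit_of_isHomogeneous h hn (isRelPrime_zero_left.1 hb)

/-- Otherwise Euler's formula would make `lin a` divide `f`. -/
theorem exists_grad_ne_zero {f : S} (hd : d ≠ 0) (hf : f.IsHomogeneous d)
    (haf : ¬ lin a ∣ f) : ∃ i, ¬ lin a ∣ grad f i := by
  by_contra h
  push Not at h
  apply haf
  have h1 : lin a ∣ C (d : ℂ) * f := by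
    rw [← dot_X_grad hf]
    exact Finset.dvd_sum fun i _ => (h i).mul_left _
  have hu : IsUnit (C (d : ℂ) : S) :=
    (isUnit_iff_ne_zero.2 (Nat.cast_ne_zero.2 hd)).map C
  exact (hu.dvd_mul_left).1 h1

/-- The syzygies of the gradient are generated by three elements. -/
theorem exists_combination_of_dot_grad_eq_zero
    (hv : ∀ i j, i ≠ j → v i ⨯₃ v j ≠ 0) (hv0 : ∀ i, v i ≠ 0) (hd : d ≠ 0)
    (hf : (∏ j ∈ s, lin (v j)).IsHomogeneous d) (haf : ¬ lin a ∣ ∏ j ∈ s, lin (v j))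
    (ha : a k ≠ 0) (hκ : κ ≠ 0)
    (h₁ : ρ₁ ⬝ᵥ grad (∏ j ∈ s, lin (v j)) = 0) (h₂ : ρ₂ ⬝ᵥ grad (∏ j ∈ s, lin (v j)) = 0)
    (hcross : ρ₁ ⨯₃ ρ₂ = (C κ * lin a) • grad (∏ j ∈ s, lin (v j)))
    (hrel : lin a • φ = b₂ • ρ₁ - b₁ • ρ₂) (hb : IsRelPrime b₁ b₂)
    (hb₁ : retract a k b₁ = b₁) (hb₂ : retract a k b₂ = b₂) (hb0 : b₁ ≠ 0)
    {η : Fin 3 → S} (hη : η ⬝ᵥ grad (∏ j ∈ s, lin (v j)) = 0) :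
    ∃ x y z : S, η = x • ρ₁ + y • ρ₂ + z • φ := by
  obtain ⟨u, hu⟩ := exists_cross_eq_smul_grad hv hv0 hd hf hη h₁
  obtain ⟨w, hw⟩ := exists_cross_eq_smul_grad hv hv0 hd hf hη h₂
  obtain ⟨k₀, hk₀⟩ := exists_grad_ne_zero hd hf haf
  set f := ∏ j ∈ s, lin (v j) with hfdef
  have ha0 : a ≠ 0 := fun h => ha (by rw [h]; rfl)
  have hα := prime_lin ha0
  have hg0 : grad f k₀ ≠ 0 := fun h => hk₀ (by rw [h]; exact dvd_zero _)
  -- The determinant of `η`, `ρ₁`, `ρ₂` vanishes, since `ρ₁ ⨯₃ ρ₂` is a multiple of the gradient. In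
  -- Cramer's relation a nonzero gradient entry then cancels.
  have hmain : ∀ i, C κ * lin a * η i = w * ρ₁ i - u * ρ₂ i := by
    intro i
    have h := congrFun (cramer_cross η ρ₁ ρ₂ k₀) i
    rw [hcross, dotProduct_smul, hη, smul_zero, Pi.single_zero, ← cross_anticomm η ρ₂, hw, hu] at h
    simp only [Pi.add_apply, Pi.smul_apply, Pi.neg_apply, smul_eq_mul, Pi.zero_apply] at h
    apply mul_left_cancel₀ hg0
    linear_combination h
  have hrel' : ∀ i, lin a * φ i = b₂ * ρ₁ i - b₁ * ρ₂ i := fun i => by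
    simpa using congrFun hrel i
  have hr0 := retract_lin_self (a := a) ha
  set r := retract a k with hr
  have e1 : ∀ i, r w * r (ρ₁ i) = r u * r (ρ₂ i) := fun i => by
    have := congrArg r (hmain i)
    simp only [map_mul, map_sub, hr0, mul_zero, zero_mul] at this
    exact (sub_eq_zero.1 this.symm)
  have e2 : ∀ i, b₂ * r (ρ₁ i) = b₁ * r (ρ₂ i) := fun i => by
    have := congrArg r (hrel' i)
    simp only [map_mul, map_sub, hr0, zero_mul, hb₁, hb₂] at this
    exact (sub_eq_zero.1 this.symm)
  -- On the line both coefficient pairs relate `ρ₁` to `ρ₂`. They are proportional unless both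
  -- vectors vanish there, and then `lin a ^ 2` would divide `ρ₁ ⨯₃ ρ₂`, although the gradient is
  -- not divisible by `lin a`.
  have e3 : r w * b₁ = r u * b₂ := by
    have k1 : ∀ i, (r w * b₁ - r u * b₂) * r (ρ₁ i) = 0 := fun i => by
      linear_combination b₁ * e1 i - r u * e2 i
    have k2 : ∀ i, (r w * b₁ - r u * b₂) * r (ρ₂ i) = 0 := fun i => by
      linear_combination b₂ * e1 i - r w * e2 i
    by_contra hne
    have hne' := sub_ne_zero.2 hne
    have d1 : ∀ i, lin a ∣ ρ₁ i := fun i =>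
      (retract_eq_zero_iff ha _).1 ((mul_eq_zero.1 (k1 i)).resolve_left hne')
    have d2 : ∀ i, lin a ∣ ρ₂ i := fun i =>
      (retract_eq_zero_iff ha _).1 ((mul_eq_zero.1 (k2 i)).resolve_left hne')
    have d3 : lin a * lin a ∣ (ρ₁ ⨯₃ ρ₂) k₀ := by
      have aux : ∀ i j, lin a * lin a ∣ ρ₁ i * ρ₂ j := fun i j => mul_dvd_mul (d1 i) (d2 j)
      fin_cases k₀ <;> simp only [cross_apply] <;> exact dvd_sub (aux _ _) (aux _ _)
    rw [hcross, Pi.smul_apply, smul_eq_mul, mul_comm (C κ), mul_assoc] at d3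
    have d4 := (mul_dvd_mul_iff_left hα.ne_zero).1 d3
    have hu : IsUnit (C κ : S) := by simpa using hκ
    exact hk₀ ((hu.dvd_mul_left).1 d4)
  obtain ⟨μ, hμ⟩ : b₁ ∣ r u := hb.dvd_of_dvd_mul_right ⟨r w, by rw [← e3, mul_comm]⟩
  have hμ' : r w = b₂ * μ := by
    apply mul_right_cancel₀ hb0
    rw [e3, hμ]; ring
  obtain ⟨u', hu'⟩ := dvd_sub_retract (a := a) (k := k) u
  obtain ⟨w', hw'⟩ := dvd_sub_retract (a := a) (k := k) w
  rw [← hr] at hu' hw'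
  have hκ1 : (C κ : S) * C κ⁻¹ = 1 := by rw [← C_mul, mul_inv_cancel₀ hκ, C_1]
  -- Substituting `w = b₂ μ + lin a * w'` and `u = b₁ μ + lin a * u'` in `hmain` makes every term a
  -- multiple of `lin a`.
  refine ⟨C κ⁻¹ * w', - C κ⁻¹ * u', C κ⁻¹ * μ, ?_⟩
  ext1 i
  simp only [Pi.add_apply, Pi.smul_apply, smul_eq_mul]
  have h5 : C κ * η i = w' * ρ₁ i - u' * ρ₂ i + μ * φ i := by
    apply mul_left_cancel₀ hα.ne_zero
    linear_combination hmain i + hw' * ρ₁ i - hu' * ρ₂ i - μ * hrel' i + hμ' * ρ₁ i - hμ * ρ₂ i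
  linear_combination (- η i) * hκ1 + C κ⁻¹ * h5

/-- The relations between the three generating syzygies. -/
theorem relation_of_combination_eq_zero {f : S} (hd : d ≠ 0)
    (hf : f.IsHomogeneous d) (haf : ¬ lin a ∣ f)
    (ha : a k ≠ 0) (hκ : κ ≠ 0) (hcross : ρ₁ ⨯₃ ρ₂ = (C κ * lin a) • grad f)
    (hrel : lin a • φ = b₂ • ρ₁ - b₁ • ρ₂) (hb₁ : retract a k b₁ = b₁) (hb0 : b₁ ≠ 0)
    {x y z : S} (h : x • ρ₁ + y • ρ₂ + z • φ = 0) :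
    ∃ t : S, x = b₂ * t ∧ y = - b₁ * t ∧ z = - lin a * t := by
  obtain ⟨k₀, hk₀⟩ := exists_grad_ne_zero hd hf haf
  have ha0 : a ≠ 0 := fun h => ha (by rw [h]; rfl)
  have hα := prime_lin ha0
  have hg0 : grad f k₀ ≠ 0 := fun h => hk₀ (by rw [h]; exact dvd_zero _)
  have hC : (C κ : S) ≠ 0 := by simpa using hκ
  -- Multiplying by `lin a` eliminates `φ`; as `ρ₁ ⨯₃ ρ₂` is nonzero, both coefficients vanish.
  have h1 : (lin a * x + z * b₂) • ρ₁ + (lin a * y - z * b₁) • ρ₂ = 0 := by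
    have : lin a • (x • ρ₁ + y • ρ₂ + z • φ) = 0 := by rw [h, smul_zero]
    rw [smul_add, smul_add, smul_comm (lin a) z φ, hrel] at this
    rw [← this]
    ext1 i
    simp only [Pi.add_apply, Pi.smul_apply, Pi.sub_apply, smul_eq_mul]
    ring
  have hne : C κ * lin a * grad f k₀ ≠ 0 := mul_ne_zero (mul_ne_zero hC hα.ne_zero) hg0
  have h2 : lin a * x + z * b₂ = 0 := by
    have := congrArg (fun w => (w ⨯₃ ρ₂) k₀) h1
    simp only [map_add, map_smul, LinearMap.add_apply, LinearMap.smul_apply, cross_self,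
      smul_zero, add_zero, map_zero, LinearMap.zero_apply, hcross, Pi.smul_apply, smul_eq_mul,
      Pi.zero_apply] at this
    exact (mul_eq_zero.1 this).resolve_right hne
  have h3 : lin a * y - z * b₁ = 0 := by
    have := congrArg (fun w => (ρ₁ ⨯₃ w) k₀) h1
    simp only [map_add, map_smul, cross_self,
      smul_zero, zero_add, map_zero, hcross, Pi.smul_apply, smul_eq_mul,
      Pi.zero_apply] at this
    exact (mul_eq_zero.1 this).resolve_right hne
  have h4 : ¬ lin a ∣ b₁ := fun h => hb0 (by rw [← hb₁]; exact (retract_eq_zero_iff ha _).2 h)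
  obtain ⟨t, ht⟩ : lin a ∣ z :=
    (hα.dvd_or_dvd (⟨y, (sub_eq_zero.1 h3).symm⟩ : lin a ∣ z * b₁)).resolve_right h4
  refine ⟨-t, ?_, ?_, ?_⟩
  · apply mul_left_cancel₀ hα.ne_zero
    linear_combination h2 - ht * b₂
  · apply mul_left_cancel₀ hα.ne_zero
    linear_combination h3 + ht * b₁
  · rw [ht]; ring

/-- The relation column is `(b₂, -b₁, -lin a)`. Positivity of `n₁` and `n₂` is what makes the
resolution minimal. -/
theorem isPlusOneGeneratedCurve_of_relation
    (hv : ∀ i j, i ≠ j → v i ⨯₃ v j ≠ 0) (hv0 : ∀ i, v i ≠ 0) {d₁ d₂ d₃ : ℕ}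
    (hd₁ : 0 < d₁) (hd₁₂ : d₁ ≤ d₂) (hd₂₃ : d₂ ≤ d₃) (hd : d₁ + d₂ = d)
    (hf : (∏ j ∈ s, lin (v j)).IsHomogeneous d) (haf : ¬ lin a ∣ ∏ j ∈ s, lin (v j))
    (ha : a k ≠ 0) (hκ : κ ≠ 0)
    (h₁ : ρ₁ ⬝ᵥ grad (∏ j ∈ s, lin (v j)) = 0) (h₂ : ρ₂ ⬝ᵥ grad (∏ j ∈ s, lin (v j)) = 0)
    (hcross : ρ₁ ⨯₃ ρ₂ = (C κ * lin a) • grad (∏ j ∈ s, lin (v j)))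
    (hrel : lin a • φ = b₂ • ρ₁ - b₁ • ρ₂) (hb : IsRelPrime b₁ b₂)
    (hb₁ : retract a k b₁ = b₁) (hb₂ : retract a k b₂ = b₂)
    (hρ₁ : ∀ i, (ρ₁ i).IsHomogeneous d₁) (hρ₂ : ∀ i, (ρ₂ i).IsHomogeneous d₂)
    (hφ : ∀ i, (φ i).IsHomogeneous d₃) (hn₁ : b₁.IsHomogeneous n₁) (hn₂ : b₂.IsHomogeneous n₂)
    (hn₁0 : 0 < n₁) (hn₂0 : 0 < n₂) (hdeg₁ : d₂ + n₁ = d₃ + 1) (hdeg₂ : d₁ + n₂ = d₃ + 1) :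
    IsPlusOneGeneratedCurve (∏ j ∈ s, lin (v j)) d d₁ d₂ d₃ := by
  have hd0 : d ≠ 0 := by omega
  have hb0 : b₁ ≠ 0 := ne_zero_of_isRelPrime hb hn₂0 hn₂
  have hgen := fun (η : Fin 3 → S) (hη : η ⬝ᵥ grad (∏ j ∈ s, lin (v j)) = 0) =>
    exists_combination_of_dot_grad_eq_zero hv hv0 hd0 hf haf ha hκ h₁ h₂ hcross hrel hb hb₁ hb₂
      hb0 hη
  have hsyz := fun (x y z : S) (h : x • ρ₁ + y • ρ₂ + z • φ = 0) =>
    relation_of_combination_eq_zero hd0 hf haf ha hκ hcross hrel hb₁ hb0 h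
  have hsq := squarefree_prod_lin hv hv0 s
  have ha0 : a ≠ 0 := fun h => ha (by rw [h]; rfl)
  have hα := lin_ne_zero ha0
  set f := ∏ j ∈ s, lin (v j) with hfdef
  have hφ0 : φ ⬝ᵥ grad f = 0 := by
    have : (lin a • φ) ⬝ᵥ grad f = 0 := by
      rw [hrel, sub_dotProduct, smul_dotProduct, smul_dotProduct, h₁, h₂]; simp
    rw [smul_dotProduct, smul_eq_mul] at this
    exact (mul_eq_zero.1 this).resolve_left hα
  let φ₂ : Matrix (Fin 3) (Fin (1 + 2)) S := Matrix.of fun i j => (![ρ₁ i, ρ₂ i, φ i] : Fin 3 → S) j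
  let φ₃ : Matrix (Fin (1 + 2)) (Fin 1) S := Matrix.of fun j _ => (![b₂, -b₁, -lin a] : Fin 3 → S) j
  have hφ₂ : ∀ c, φ₂.mulVecLin c = c 0 • ρ₁ + c 1 • ρ₂ + c 2 • φ := by
    intro c
    ext1 i
    simp only [φ₂, mulVecLin_apply, mulVec, Pi.add_apply, Pi.smul_apply, smul_eq_mul]
    rw [dotProduct, Fin.sum_univ_three]
    simp [mul_comm]
  have hφ₃ : ∀ c, φ₃.mulVecLin c = ![b₂ * c 0, - b₁ * c 0, - lin a * c 0] := by
    intro c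
    ext1 i
    fin_cases i <;> simp [φ₃, mulVec, dotProduct]
  -- The last twist is `(d - 1 + d₃) + 1`: the generator `φ` enters the relation with the linear
  -- coefficient `-lin a`.
  refine ⟨⟨⟨by omega, hf, hsq⟩, ?_, ?_, ![d + d₃], grad f, φ₂, φ₃, ?_, ?_, ?_, ?_, ?_, ?_, ?_,
    ?_, ?_, ?_, ?_⟩, hd⟩
  · intro i; fin_cases i <;> simp <;> omega
  · refine Fin.monotone_iff_le_succ.2 fun i => ?_
    fin_cases i
    · exact hd₁₂
    · exact hd₂₃
  · exact fun i j _ => by rw [Subsingleton.elim i j]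
  · exact isHomogeneous_grad hf
  · intro i j
    right
    fin_cases j
    · exact ⟨d₁, rfl, hρ₁ i⟩
    · exact ⟨d₂, rfl, hρ₂ i⟩
    · exact ⟨d₃, rfl, hφ i⟩
  · intro i j
    right
    fin_cases i
    · exact ⟨n₂, by simp; omega, hn₂⟩
    · exact ⟨n₁, by simp; omega, hn₁.neg⟩
    · exact ⟨1, by simp; omega, (isHomogeneous_lin a).neg⟩
  · exact fun i => constantCoeff_eq_zero_of_isHomogeneous (isHomogeneous_grad hf i) (by omega)
  · intro i j
    fin_cases j
    · exact constantCoeff_eq_zero_of_isHomogeneous (hρ₁ i) hd₁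
    · exact constantCoeff_eq_zero_of_isHomogeneous (hρ₂ i) (by omega)
    · exact constantCoeff_eq_zero_of_isHomogeneous (hφ i) (by omega)
  · intro i j
    fin_cases i
    · exact constantCoeff_eq_zero_of_isHomogeneous hn₂ hn₂0
    · exact constantCoeff_eq_zero_of_isHomogeneous hn₁.neg hn₁0
    · exact constantCoeff_eq_zero_of_isHomogeneous (isHomogeneous_lin a).neg one_pos
  · rw [← LinearMap.ker_eq_bot, LinearMap.ker_eq_bot']
    intro c hc
    rw [hφ₃] at hc
    have := congrFun hc 2
    simp [hα] at this
    ext1 i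
    rw [Subsingleton.elim i 0]; exact this
  · intro c
    constructor
    · intro hc
      rw [hφ₂] at hc
      obtain ⟨t, h0, h1, h2⟩ := hsyz _ _ _ hc
      refine ⟨fun _ => t, ?_⟩
      rw [hφ₃]
      ext1 i
      fin_cases i
      · exact h0.symm
      · exact h1.symm
      · exact h2.symm
    · rintro ⟨c, rfl⟩
      rw [hφ₂, hφ₃]
      ext1 i
      have := congrFun hrel i
      simp at this ⊢
      linear_combination (-c 0) * this
  · have hlc : ∀ c : Fin 3 → S, Fintype.linearCombination S (grad f) c = c ⬝ᵥ grad f := fun c => by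
      simp [Fintype.linearCombination_apply, dotProduct]
    intro c
    rw [hlc]
    constructor
    · intro hc
      obtain ⟨x, y, z, h⟩ := hgen c hc
      refine ⟨![x, y, z], ?_⟩
      rw [hφ₂, h]; simp
    · rintro ⟨c, rfl⟩
      rw [hφ₂]
      simp [add_dotProduct, h₁, h₂, hφ0]
  · exact Fintype.range_linearCombination S _

end Resolution

/-! ### Vector fields restricted to the deleted line -/

section Restriction

variable {a : Fin 3 → ℂ} {k : Fin 3}

/-- Normalising a vector field tangent to a line by the Euler field, so that it annihilates the
equation of the line. -/
theorem exists_sub_smul_X_dot_cvec (ha : a k ≠ 0) {η : Fin 3 → S} {e : ℕ}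
    (hη : ∀ i, (η i).IsHomogeneous (e + 1)) (h : lin a ∣ cvec a ⬝ᵥ η) :
    ∃ g : S, cvec a ⬝ᵥ (η - g • X) = 0 ∧
      ∀ i, ((η - g • (X : Fin 3 → S)) i).IsHomogeneous (e + 1) := by
  have ha0 : a ≠ 0 := fun h => ha (by rw [h]; rfl)
  obtain ⟨g, hg⟩ := h
  have hgh : g.IsHomogeneous e := by
    refine isHomogeneous_of_mul (isHomogeneous_lin a) (lin_ne_zero ha0) ?_
    rw [← hg, show 1 + e = 0 + (e + 1) by omega]
    exact isHomogeneous_dot (fun i => isHomogeneous_C _ _) hη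
  refine ⟨g, ?_, fun i => (hη i).sub (hgh.mul (isHomogeneous_X _ i))⟩
  rw [dotProduct_sub, hg, dotProduct_smul, dot_X_cvec, smul_eq_mul]
  ring

/-- Both fields are orthogonal to the constant vector `a`, so their cross product is parallel to it;
pairing with `X` determines the factor. -/
theorem cross_eq_of_dot_eq_zero (ha : a k ≠ 0) {θ₁ θ₂ : Fin 3 → S} {q : S}
    (h₁ : cvec a ⬝ᵥ θ₁ = 0) (h₂ : cvec a ⬝ᵥ θ₂ = 0) (h : X ⬝ᵥ θ₁ ⨯₃ θ₂ = lin a * q) :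
    θ₁ ⨯₃ θ₂ = q • cvec a := by
  have ha0 : a ≠ 0 := fun h => ha (by rw [h]; rfl)
  have hcr : cvec a ⨯₃ (θ₁ ⨯₃ θ₂) = 0 := by
    rw [cross_cross_eq_smul_sub_smul', h₂, dotProduct_comm θ₁, h₁]; simp
  have := smul_eq_of_cross_eq_zero hcr X
  rw [h, dotProduct_comm, dot_X_cvec] at this
  ext1 i
  apply mul_left_cancel₀ (lin_ne_zero ha0)
  have := congrFun this i
  simp only [Pi.smul_apply, smul_eq_mul] at this ⊢
  rw [this]; ring

/-- The restriction to the line `lin a = 0` of a vector of polynomials. -/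
noncomputable def rvec (a : Fin 3 → ℂ) (k : Fin 3) (η : Fin 3 → S) : Fin 3 → S :=
  fun i => retract a k (η i)

theorem retract_dot_cvec (w : Fin 3 → ℂ) (η : Fin 3 → S) :
    retract a k (cvec w ⬝ᵥ η) = cvec w ⬝ᵥ rvec a k η := by
  rw [show retract a k (cvec w ⬝ᵥ η) = (retract a k : S →+* S) (cvec w ⬝ᵥ η) from rfl, map_dot]
  congr 1
  ext1 i
  exact retract_C _

theorem rvec_cross (η ρ : Fin 3 → S) : rvec a k (η ⨯₃ ρ) = rvec a k η ⨯₃ rvec a k ρ := by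
  ext1 i
  exact map_cross (retract a k : S →+* S) η ρ i

theorem rvec_smul_cvec (p : S) (w : Fin 3 → ℂ) : rvec a k (p • cvec w) = retract a k p • cvec w := by
  ext1 i
  simp only [rvec, Pi.smul_apply, smul_eq_mul, map_mul]
  rw [cvec, retract_C]

theorem rvec_rvec (ha : a k ≠ 0) (η : Fin 3 → S) : rvec a k (rvec a k η) = rvec a k η := by
  ext1 i
  exact retract_retract ha _

theorem dot_rvec_X (ha : a k ≠ 0) : cvec a ⬝ᵥ rvec a k X = 0 := by
  rw [← retract_dot_cvec, dot_X_cvec, retract_lin_self ha]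

/-- The coefficient vector of the restriction of a linear form. -/
noncomputable def red (a : Fin 3 → ℂ) (k : Fin 3) (w : Fin 3 → ℂ) : Fin 3 → ℂ :=
  w - (w k / a k) • a

theorem retract_lin_eq (w : Fin 3 → ℂ) : retract a k (lin w) = lin (red a k w) := retract_lin w

theorem cross_red (w : Fin 3 → ℂ) : a ⨯₃ red a k w = a ⨯₃ w := by
  simp [red]

theorem red_apply_self (ha : a k ≠ 0) (w : Fin 3 → ℂ) : red a k w k = 0 := by
  simp [red, ha]

theorem red_red (ha : a k ≠ 0) (w : Fin 3 → ℂ) : red a k (red a k w) = red a k w := by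
  conv_lhs => rw [red, red_apply_self ha]
  simp

theorem det_red (w w' : Fin 3 → ℂ) : a ⬝ᵥ w ⨯₃ w' = a ⬝ᵥ red a k w ⨯₃ red a k w' := by
  simp only [dot_expand, cross_apply, red, Pi.sub_apply, Pi.smul_apply, smul_eq_mul, cons_val]
  ring

theorem red_ne_zero {w : Fin 3 → ℂ} (h : a ⨯₃ w ≠ 0) : red a k w ≠ 0 := fun h0 => by
  rw [← cross_red (k := k), h0] at h; simp at h

/-- Vectors whose `k`-th coordinate vanishes lie in a plane transversal to `a`. -/
theorem cross_red_red (ha : a k ≠ 0) (w w' : Fin 3 → ℂ) :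
    red a k w ⨯₃ red a k w' = ((a ⬝ᵥ w ⨯₃ w') / a k) • Pi.single k 1 := by
  rw [det_red (k := k)]
  have h1 := red_apply_self ha w
  have h2 := red_apply_self ha w'
  generalize red a k w = x at *
  generalize red a k w' = y at *
  rw [dot_expand]
  ext i
  fin_cases k <;> fin_cases i <;> simp_all [cross_apply]

theorem exists_red_eq_smul (ha : a k ≠ 0) {w w' : Fin 3 → ℂ} (hw : a ⨯₃ w ≠ 0)
    (h : a ⬝ᵥ w ⨯₃ w' = 0) : ∃ t : ℂ, red a k w' = t • red a k w := by
  have h1 : red a k w ⨯₃ red a k w' = 0 := by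
    rw [cross_red_red ha, h]; simp
  obtain ⟨i, hi⟩ := Function.ne_iff.1 (red_ne_zero (k := k) hw)
  have h2 := smul_eq_of_cross_eq_zero h1 (Pi.single i 1)
  simp only [single_dotProduct, one_mul] at h2
  refine ⟨red a k w' i / red a k w i, ?_⟩
  rw [div_eq_inv_mul, mul_smul, ← h2, smul_smul, inv_mul_cancel₀ hi, one_smul]

theorem cross_red_ne_zero {w : Fin 3 → ℂ} (h : a ⨯₃ w ≠ 0) : red a k w ⨯₃ a ≠ 0 := by
  rwa [← cross_anticomm, neg_ne_zero, cross_red]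

/-- The coefficient with respect to `a` of the cross product of two vectors orthogonal to `a`. -/
theorem exists_cross_rvec_X (ha : a k ≠ 0) {θ : Fin 3 → S} {e : ℕ}
    (hθ : ∀ i, (θ i).IsHomogeneous e) (h : cvec a ⬝ᵥ θ = 0) :
    ∃ Δ : S, rvec a k θ ⨯₃ rvec a k X = Δ • cvec a ∧ Δ.IsHomogeneous (e + 1) ∧
      retract a k Δ = Δ := by
  have ha0 : a ≠ 0 := fun h => ha (by rw [h]; rfl)
  have hcr : cvec a ⨯₃ (rvec a k θ ⨯₃ rvec a k X) = 0 := by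
    rw [cross_cross_eq_smul_sub_smul', dot_rvec_X ha, dotProduct_comm, ← retract_dot_cvec, h]
    simp
  have h1 := smul_eq_of_cross_eq_zero hcr (Pi.single k 1)
  simp only [single_dotProduct, one_mul] at h1
  have hC : (C (a k) : S) * C (a k)⁻¹ = 1 := by rw [← C_mul, mul_inv_cancel₀ ha, C_1]
  have h2 : rvec a k θ ⨯₃ rvec a k X =
      (C (a k)⁻¹ * (rvec a k θ ⨯₃ rvec a k X) k) • cvec a := by
    ext1 i
    have := congrFun h1 i
    simp only [Pi.smul_apply, smul_eq_mul] at this ⊢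
    rw [cvec] at this
    linear_combination (-(rvec a k θ ⨯₃ rvec a k X) i) * hC + C (a k)⁻¹ * this
  refine ⟨_, h2, ?_, ?_⟩
  · exact (isHomogeneous_cross (fun i => isHomogeneous_retract (hθ i))
      (fun i => isHomogeneous_retract (isHomogeneous_X _ i)) k).C_mul _
  · have := congrArg (rvec a k) h2
    rw [rvec_cross, rvec_rvec ha, rvec_rvec ha, rvec_smul_cvec] at this
    exact smul_cvec_cancel ha0 (this.symm.trans h2)

end Restriction

/-! ### Multiplicities at the points of the line and coprimality -/

section Points

variable {ι : Type*} {v : ι → Fin 3 → ℂ} {a : Fin 3 → ℂ} {k : Fin 3}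

/-- A vector field tangent to several lines through a point of the line `lin a = 0` is tangent to
the point with multiplicity. -/
theorem pow_dvd_dot_rvec (hv : ∀ i j, i ≠ j → v i ⨯₃ v j ≠ 0) {J : Finset ι} {w : Fin 3 → ℂ}
    {t : ι → ℂ} (ht : ∀ j ∈ J, t j ≠ 0 ∧ red a k (v j) = t j • red a k w) {θ : Fin 3 → S}
    (hθ : cvec a ⬝ᵥ θ = 0) (h : ∀ j ∈ J, lin (v j) ∣ cvec (v j) ⬝ᵥ θ) :
    lin (red a k w) ^ J.card ∣ cvec (red a k w) ⬝ᵥ rvec a k θ := by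
  -- Modulo `a`, all `v j` are multiples of one vector, and `θ` kills `a`: every `lin (v j)` divides
  -- the same polynomial. Their product must be formed before restricting, because the restricted
  -- forms are no longer coprime.
  have hY : ∀ j ∈ J, lin (v j) ∣ cvec (red a k w) ⬝ᵥ θ := by
    intro j hj
    obtain ⟨ht0, hred⟩ := ht j hj
    have e : cvec (v j) = (C (t j) : S) • cvec (red a k w) + (C (v j k / a k) : S) • cvec a := by
      have : v j = t j • red a k w + (v j k / a k) • a := by
        rw [← hred, red]; simp
      ext1 i
      have := congrFun this i
      simp only [cvec, Pi.add_apply, Pi.smul_apply, smul_eq_mul] at this ⊢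
      rw [this]; simp
    have h' := h j hj
    rw [e, add_dotProduct, smul_dotProduct, smul_dotProduct, hθ, smul_zero, add_zero,
      smul_eq_mul] at h'
    have hu : IsUnit (C (t j) : S) := (isUnit_iff_ne_zero.2 ht0).map C
    exact (hu.dvd_mul_left).1 h'
  have hprod := Finset.prod_dvd_of_isRelPrime (pairwise_isRelPrime_lin hv J) hY
  have h2 := map_dvd (retract a k) hprod
  rw [map_prod, retract_dot_cvec, Finset.prod_congr rfl fun j hj => by
    rw [retract_lin_eq, (ht j hj).2, lin_smul], Finset.prod_mul_distrib, Finset.prod_const] at h2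
  exact (dvd_mul_left _ _).trans h2

/-- The cross product formula at a point of the line. -/
theorem smul_cvec_cross_eq (ha : a k ≠ 0) {θ : Fin 3 → S} {Δ : S}
    (hΔ : rvec a k θ ⨯₃ rvec a k X = Δ • cvec a) (w : Fin 3 → ℂ) :
    Δ • cvec (red a k w ⨯₃ a) = lin (red a k w) • rvec a k θ
      - (cvec (red a k w) ⬝ᵥ rvec a k θ) • rvec a k X := by
  rw [← cvec_cross, ← map_smul, ← hΔ, cross_cross_eq_smul_sub_smul', ← retract_dot_cvec,
    dot_X_cvec, retract_lin_eq, red_red ha, dotProduct_comm (rvec a k θ)]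

/-- By the relation, a common prime factor of `b₁` and `b₂` divides the coefficient of `X`, so it is
the equation of a point of multiplicity at least two. Both restricted fields are then divisible by
it, and their cross product contains it once more than `hcross` allows. -/
theorem isRelPrime_of_relation {P : Finset ι} {u : ι → Fin 3 → ℂ} {m : ι → ℕ} {c : ℂ} (hc : c ≠ 0)
    (hP : ∀ p ∈ P, ∀ q ∈ P, p ≠ q → IsRelPrime (lin (u p)) (lin (u q)))
    (hu0 : ∀ p ∈ P, u p ≠ 0) (hua : ∀ p ∈ P, u p ⨯₃ a ≠ 0) {b₁ b₂ : S} {ψ₁ ψ₂ : Fin 3 → S}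
    (e₁ : ∀ p ∈ P, ((∏ p ∈ P, lin (u p)) * b₁) • cvec (u p ⨯₃ a) =
      lin (u p) • ψ₁ - (cvec (u p) ⬝ᵥ ψ₁) • rvec a k X)
    (e₂ : ∀ p ∈ P, ((∏ p ∈ P, lin (u p)) * b₂) • cvec (u p ⨯₃ a) =
      lin (u p) • ψ₂ - (cvec (u p) ⬝ᵥ ψ₂) • rvec a k X)
    (hY₁ : ∀ p ∈ P, lin (u p) ^ m p ∣ cvec (u p) ⬝ᵥ ψ₁)
    (hY₂ : ∀ p ∈ P, lin (u p) ^ m p ∣ cvec (u p) ⬝ᵥ ψ₂)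
    (hrel : b₂ • ψ₁ - b₁ • ψ₂ + (C c * ∏ p ∈ P, lin (u p) ^ (m p - 1)) • rvec a k X = 0)
    (hcross : ψ₁ ⨯₃ ψ₂ = (C c * ∏ p ∈ P, lin (u p) ^ m p) • cvec a) :
    IsRelPrime b₁ b₂ := by
  classical
  have hcu : IsUnit (C c : S) := (isUnit_iff_ne_zero.2 hc).map C
  have key : ∀ z : S, Irreducible z → z ∣ b₁ → ¬ z ∣ b₂ := by
    intro z hz h₁ h₂
    have hzp := hz.prime
    -- The two variables other than `X k` survive restriction and are coprime, so `z` cannot divide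
    -- both.
    have hγ : z ∣ C c * ∏ p ∈ P, lin (u p) ^ (m p - 1) := by
      by_contra hn
      have hX : ∀ i, i ≠ k → z ∣ X i := by
        intro i hi
        have h := congrFun hrel i
        simp only [Pi.add_apply, Pi.sub_apply, Pi.smul_apply, smul_eq_mul, rvec, Pi.zero_apply,
          retract_X_of_ne hi] at h
        refine (hzp.dvd_or_dvd ?_).resolve_left hn
        rw [eq_neg_of_add_eq_zero_right h]
        exact (dvd_sub (h₂.mul_right _) (h₁.mul_right _)).neg_right
      obtain ⟨i, j, hi, hj, hij⟩ : ∃ i j : Fin 3, i ≠ k ∧ j ≠ k ∧ i ≠ j := by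
        fin_cases k
        exacts [⟨1, 2, by decide⟩, ⟨0, 2, by decide⟩, ⟨0, 1, by decide⟩]
      have hrp : IsRelPrime (X i : S) (X j) :=
        ((X_prime (R := ℂ) (i := i)).irreducible.isRelPrime_iff_not_dvd).2 fun h => hij (X_dvd_X.1 h)
      exact hz.not_isUnit (hrp (hX i hi) (hX j hj))
    obtain ⟨p, hp, hzq⟩ := (hzp.dvd_finsetProd_iff _).1 ((hcu.dvd_mul_left).1 hγ)
    have hm : 2 ≤ m p := by
      by_contra hlt
      rw [show m p - 1 = 0 by omega, pow_zero] at hzq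
      exact hz.not_isUnit (isUnit_of_dvd_one hzq)
    have hq := prime_lin (hu0 p hp)
    have hqz : lin (u p) ∣ z :=
      ((hz.dvd_comm hq.irreducible).1 (hzp.dvd_of_dvd_pow hzq))
    -- In the formula at `p` the product over `P` and `b` each contribute one factor `lin (u p)`,
    -- and `m p ≥ 2` handles the other term; one factor cancels against the coefficient of `ψ`.
    have hsq : ∀ {b : S} {ψ : Fin 3 → S}, z ∣ b → lin (u p) ^ m p ∣ cvec (u p) ⬝ᵥ ψ →
        ((∏ p ∈ P, lin (u p)) * b) • cvec (u p ⨯₃ a) =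
          lin (u p) • ψ - (cvec (u p) ⬝ᵥ ψ) • rvec a k X → ∀ i, lin (u p) ∣ ψ i := by
      intro b ψ hb hY he i
      have h1 : lin (u p) * lin (u p) ∣ (∏ p ∈ P, lin (u p)) * b :=
        mul_dvd_mul (Finset.dvd_prod_of_mem _ hp) (hqz.trans hb)
      have h2 : lin (u p) * lin (u p) ∣ cvec (u p) ⬝ᵥ ψ := by
        rw [← pow_two]; exact (pow_dvd_pow _ hm).trans hY
      have h3 := congrFun he i
      simp only [Pi.sub_apply, Pi.smul_apply, smul_eq_mul] at h3
      refine (mul_dvd_mul_iff_left hq.ne_zero).1 ?_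
      rw [sub_eq_iff_eq_add.1 h3.symm]
      exact dvd_add (h1.mul_right _) (h2.mul_right _)
    have d₁ := hsq h₁ (hY₁ p hp) (e₁ p hp)
    have d₂ := hsq h₂ (hY₂ p hp) (e₂ p hp)
    have hbig : lin (u p) ^ m p * lin (u p) ∣ C c * ∏ p ∈ P, lin (u p) ^ m p := by
      refine dvd_of_dvd_smul_cvec (hua p hp) fun i => ?_
      rw [← cvec_cross, ← map_smul, ← hcross, cross_cross_eq_smul_sub_smul',
        dotProduct_comm ψ₁]
      simp only [Pi.sub_apply, Pi.smul_apply, smul_eq_mul]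
      exact dvd_sub (mul_dvd_mul (hY₂ p hp) (d₁ i)) (mul_dvd_mul (hY₁ p hp) (d₂ i))
    rw [← Finset.mul_prod_erase P _ hp] at hbig
    have h4 := (mul_dvd_mul_iff_left (pow_ne_zero _ hq.ne_zero)).1
      ((hcu.dvd_mul_left).1 hbig)
    obtain ⟨p', hp', h5⟩ := (hq.dvd_finsetProd_iff _).1 h4
    exact hq.not_isUnit (hP p hp p' (Finset.mem_of_mem_erase hp')
      (Finset.ne_of_mem_erase hp').symm dvd_rfl (hq.dvd_of_dvd_pow h5))
  -- The remaining case `b₁ = b₂ = 0` is excluded by `key` for any irreducible, for instance a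
  -- variable.
  refine WfDvdMonoid.isRelPrime_of_no_irreducible_factors ?_ key
  rintro ⟨rfl, rfl⟩
  exact key (X 0) (X_prime (R := ℂ) (i := (0 : Fin 3))).irreducible (dvd_zero _) (dvd_zero _)

end Points

/-! ### Deletion of a line from a free arrangement -/

section Deletion

variable {ι : Type*} [Fintype ι] [DecidableEq ι]

/-- Deleting a line from a free arrangement of `d₁ + d₂ + 1` lines with exponents `(1, d₁, d₂)`
(in the form of Saito's criterion) gives a plus-one generated arrangement. The finset `P` contains
one line through each of the intersection points on the deleted line. -/
theorem isPlusOneGeneratedCurve_deletion {v : ι → Fin 3 → ℂ}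
    (hv : ∀ i j, i ≠ j → v i ⨯₃ v j ≠ 0) (hv0 : ∀ i, v i ≠ 0) (i₀ : ι) {P : Finset ι} (hP : i₀ ∉ P)
    (hcover : ∀ j, j ≠ i₀ → ∃ p ∈ P, v i₀ ⬝ᵥ v p ⨯₃ v j = 0)
    (hind : ∀ p ∈ P, ∀ q ∈ P, p ≠ q → v i₀ ⬝ᵥ v p ⨯₃ v q ≠ 0)
    {d₁ d₂ d₃ d : ℕ} (h₁₂ : d₁ ≤ d₂) (h₂₃ : d₂ ≤ d₃) (hd : d₁ + d₂ = d)
    (hcard : Fintype.card ι = d + 1) (hPcard : d₃ + P.card = d) (hP₁ : P.card ≤ d₁)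
    (hd₁ : 0 < d₁) {θ₁ θ₂ : Fin 3 → S} (hθ₁ : ∀ i, (θ₁ i).IsHomogeneous d₁)
    (hθ₂ : ∀ i, (θ₂ i).IsHomogeneous d₂)
    (ht₁ : ∀ j, lin (v j) ∣ cvec (v j) ⬝ᵥ θ₁) (ht₂ : ∀ j, lin (v j) ∣ cvec (v j) ⬝ᵥ θ₂)
    {c : ℂ} (hc : c ≠ 0) (hsaito : X ⬝ᵥ θ₁ ⨯₃ θ₂ = C c * ∏ j, lin (v j)) :
    IsPlusOneGeneratedCurve (∏ j ∈ Finset.univ.erase i₀, lin (v j)) d d₁ d₂ d₃ := by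
  obtain ⟨k, ha⟩ := Function.ne_iff.1 (hv0 i₀)
  set a := v i₀ with hadef
  change a k ≠ 0 at ha
  have ha0 : a ≠ 0 := hv0 i₀
  have hα := lin_ne_zero ha0
  set s := Finset.univ.erase i₀ with hs
  have hne : ∀ j ∈ s, j ≠ i₀ := fun j hj => Finset.ne_of_mem_erase hj
  have hscard : s.card = d := by
    rw [hs, Finset.card_erase_of_mem (Finset.mem_univ _), Finset.card_univ, hcard]; rfl
  have hf : (∏ j ∈ s, lin (v j)).IsHomogeneous d := by
    have := IsHomogeneous.prod s (fun j => lin (v j)) (fun _ => 1) fun j _ => isHomogeneous_lin _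
    simpa [hscard] using this
  have haf : ¬ lin a ∣ ∏ j ∈ s, lin (v j) := fun h => by
    obtain ⟨j, hj, h'⟩ := ((prime_lin ha0).dvd_finsetProd_iff _).1 h
    exact hv i₀ j (hne j hj).symm (proportional_of_lin_dvd h')
  have hsplit : ∏ j, lin (v j) = lin a * ∏ j ∈ s, lin (v j) :=
    (Finset.mul_prod_erase _ _ (Finset.mem_univ i₀)).symm
  have hd0 : d ≠ 0 := by omega
  obtain ⟨e₁, rfl⟩ : ∃ e, d₁ = e + 1 := ⟨d₁ - 1, by omega⟩
  obtain ⟨e₂, rfl⟩ : ∃ e, d₂ = e + 1 := ⟨d₂ - 1, by omega⟩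
  -- normalisation along the deleted line
  obtain ⟨g₁, ha₁, hτ₁⟩ := exists_sub_smul_X_dot_cvec ha hθ₁ (ht₁ i₀)
  obtain ⟨g₂, ha₂, hτ₂⟩ := exists_sub_smul_X_dot_cvec ha hθ₂ (ht₂ i₀)
  have htan : ∀ (w : Fin 3 → ℂ) (η : Fin 3 → S) (g : S), lin w ∣ cvec w ⬝ᵥ η →
      lin w ∣ cvec w ⬝ᵥ (η - g • (X : Fin 3 → S)) := fun w η g h => by
    rw [dotProduct_sub, dotProduct_smul, smul_eq_mul]
    exact dvd_sub h ((tangent_X w).mul_left _)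
  have hdetX : ∀ (η ρ : Fin 3 → S) (g h : S),
      X ⬝ᵥ (η - g • (X : Fin 3 → S)) ⨯₃ (ρ - h • (X : Fin 3 → S)) = X ⬝ᵥ η ⨯₃ ρ := by
    intro η ρ g h
    simp [dotProduct_sub]
  have ht₁' := fun j => htan (v j) θ₁ g₁ (ht₁ j)
  have ht₂' := fun j => htan (v j) θ₂ g₂ (ht₂ j)
  have hsaito' := hdetX θ₁ θ₂ g₁ g₂
  rw [hsaito, hsplit] at hsaito'
  generalize θ₁ - g₁ • (X : Fin 3 → S) = τ₁ at ha₁ hτ₁ ht₁' hsaito'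
  generalize θ₂ - g₂ • (X : Fin 3 → S) = τ₂ at ha₂ hτ₂ ht₂' hsaito'
  set f := ∏ j ∈ s, lin (v j) with hfdef
  have hcross : τ₁ ⨯₃ τ₂ = (C c * f) • cvec a :=
    cross_eq_of_dot_eq_zero ha ha₁ ha₂ (by rw [hsaito']; ring)
  -- the points on the deleted line
  have hcl : ∀ j, ∃ p, ∃ t : ℂ, j ≠ i₀ → p ∈ P ∧ t ≠ 0 ∧ red a k (v j) = t • red a k (v p) := by
    intro j
    by_cases hj : j = i₀
    -- Junk values for the deleted line itself, which lies in no class.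
    · exact ⟨j, 0, fun h => absurd hj h⟩
    obtain ⟨p, hp, h⟩ := hcover j hj
    have hp0 : i₀ ≠ p := fun h => hP (h ▸ hp)
    obtain ⟨t, ht⟩ := exists_red_eq_smul ha (hv i₀ p hp0) h
    refine ⟨p, t, fun _ => ⟨hp, ?_, ht⟩⟩
    rintro rfl
    rw [zero_smul] at ht
    exact red_ne_zero (hv i₀ j (Ne.symm hj)) ht
  choose cl t hclt using hcl
  have hclP : ∀ p ∈ P, cl p = p := by
    intro p hp
    by_contra hne
    obtain ⟨h1, h2, h3⟩ := hclt p fun h => hP (h ▸ hp)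
    refine hind p hp (cl p) h1 (Ne.symm hne) ?_
    rw [det_red (k := k), h3]; simp
  let J : ι → Finset ι := fun p => s.filter fun j => cl j = p
  let m : ι → ℕ := fun p => (J p).card
  let u : ι → Fin 3 → ℂ := fun p => red a k (v p)
  have hJ : ∀ p, ∀ j ∈ J p, t j ≠ 0 ∧ red a k (v j) = t j • red a k (v p) := by
    intro p j hj
    obtain ⟨hj1, rfl⟩ := Finset.mem_filter.1 hj
    exact (hclt j (hne j hj1)).2
  have hm : ∀ p ∈ P, 0 < m p := fun p hp => Finset.card_pos.2 ⟨p, Finset.mem_filter.2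
    ⟨Finset.mem_erase.2 ⟨fun h => hP (h ▸ hp), Finset.mem_univ _⟩, hclP p hp⟩⟩
  have hP0 : ∀ p ∈ P, i₀ ≠ p := fun p hp h => hP (h ▸ hp)
  have hu0 : ∀ p ∈ P, u p ≠ 0 := fun p hp => red_ne_zero (hv i₀ p (hP0 p hp))
  have hua : ∀ p ∈ P, u p ⨯₃ a ≠ 0 := fun p hp => cross_red_ne_zero (hv i₀ p (hP0 p hp))
  have hPrel : ∀ p ∈ P, ∀ q ∈ P, p ≠ q → IsRelPrime (lin (u p)) (lin (u q)) := by
    intro p hp q hq hpq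
    refine isRelPrime_lin ?_
    rw [cross_red_red ha]
    intro h
    have := congrFun h k
    simp [ha, hind p hp q hq hpq] at this
  set T := ∏ j ∈ s, t j with hT
  have hT0 : T ≠ 0 := Finset.prod_ne_zero_iff.2 fun j hj => (hclt j (hne j hj)).2.1
  -- Grouping the remaining lines by their point on the deleted line: `m p` of them pass through
  -- `p`.
  have hrf : retract a k f = C T * ∏ p ∈ P, lin (u p) ^ m p := by
    rw [hfdef, map_prod, Finset.prod_congr rfl fun j hj => by
      rw [retract_lin_eq, (hclt j (hne j hj)).2.2, lin_smul], Finset.prod_mul_distrib, hT,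
      map_prod, ← Finset.prod_fiberwise_of_maps_to
        (fun j hj => (hclt j (hne j hj)).1) fun j => lin (red a k (v (cl j)))]
    congr 1
    refine Finset.prod_congr rfl fun p _ => ?_
    rw [Finset.prod_congr rfl fun j hj => by rw [(Finset.mem_filter.1 hj).2], Finset.prod_const]
  have hY₁ : ∀ p ∈ P, lin (u p) ^ m p ∣ cvec (u p) ⬝ᵥ rvec a k τ₁ := fun p _ =>
    pow_dvd_dot_rvec hv (hJ p) ha₁ fun j _ => ht₁' j
  have hY₂ : ∀ p ∈ P, lin (u p) ^ m p ∣ cvec (u p) ⬝ᵥ rvec a k τ₂ := fun p _ =>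
    pow_dvd_dot_rvec hv (hJ p) ha₂ fun j _ => ht₂' j
  -- the coefficients of the relation
  obtain ⟨Δ₁, hΔ₁, hΔ₁h, hΔ₁r⟩ := exists_cross_rvec_X ha hτ₁ ha₁
  obtain ⟨Δ₂, hΔ₂, hΔ₂h, hΔ₂r⟩ := exists_cross_rvec_X ha hτ₂ ha₂
  set π := ∏ p ∈ P, lin (u p) with hπ
  have hπdvd : ∀ (Δ : S) (ψ : Fin 3 → S), rvec a k ψ ⨯₃ rvec a k X = Δ • cvec a →
      (∀ p ∈ P, lin (u p) ^ m p ∣ cvec (u p) ⬝ᵥ rvec a k ψ) → π ∣ Δ := by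
    intro Δ ψ hΔ hY
    refine Finset.prod_dvd_of_isRelPrime (fun p hp q hq hpq => hPrel p hp q hq hpq) fun p hp => ?_
    refine dvd_of_dvd_smul_cvec (hua p hp) fun i => ?_
    rw [smul_cvec_cross_eq ha hΔ]
    exact dvd_sub (dvd_mul_right _ _) (((dvd_pow_self _ (hm p hp).ne').trans (hY p hp)).mul_right _)
  obtain ⟨b₁, hb₁⟩ := hπdvd Δ₁ τ₁ hΔ₁ hY₁
  obtain ⟨b₂, hb₂⟩ := hπdvd Δ₂ τ₂ hΔ₂ hY₂
  have hπ0 : π ≠ 0 := Finset.prod_ne_zero_iff.2 fun p hp => lin_ne_zero (hu0 p hp)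
  have hπr : retract a k π = π := by
    rw [hπ, map_prod]
    exact Finset.prod_congr rfl fun p _ => by rw [retract_lin_eq, red_red ha]
  have hπh : π.IsHomogeneous P.card := by
    have := IsHomogeneous.prod P (fun p => lin (u p)) (fun _ => 1) fun j _ => isHomogeneous_lin _
    simpa using this
  have hbr : ∀ Δ b : S, retract a k Δ = Δ → Δ = π * b → retract a k b = b := by
    intro Δ b h1 h2
    rw [h2, map_mul, hπr] at h1
    exact mul_left_cancel₀ hπ0 h1
  have hb₁r := hbr _ _ hΔ₁r hb₁
  have hb₂r := hbr _ _ hΔ₂r hb₂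
  -- The degree is `d₁ + 1 - P.card`, positive because `P.card ≤ d₁`.
  have hn₁ : b₁.IsHomogeneous (e₁ + 2 - P.card) := isHomogeneous_of_mul hπh hπ0 (by
    rw [← hb₁, show P.card + (e₁ + 2 - P.card) = e₁ + 1 + 1 by omega]; exact hΔ₁h)
  have hn₂ : b₂.IsHomogeneous (e₂ + 2 - P.card) := isHomogeneous_of_mul hπh hπ0 (by
    rw [← hb₂, show P.card + (e₂ + 2 - P.card) = e₂ + 1 + 1 by omega]; exact hΔ₂h)
  have hcr : rvec a k τ₁ ⨯₃ rvec a k τ₂ = (C (c * T) * ∏ p ∈ P, lin (u p) ^ m p) • cvec a := by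
    rw [← rvec_cross, hcross, rvec_smul_cvec, map_mul, retract_C, hrf, C_mul, mul_assoc]
  have hcT : c * T ≠ 0 := mul_ne_zero hc hT0
  set γ := C (c * T) * ∏ p ∈ P, lin (u p) ^ (m p - 1) with hγ
  have hπγ : C (c * T) * ∏ p ∈ P, lin (u p) ^ m p = π * γ := by
    rw [hγ, mul_left_comm, hπ, ← Finset.prod_mul_distrib]
    congr 1
    refine Finset.prod_congr rfl fun p hp => ?_
    rw [← pow_succ', Nat.sub_add_cancel (hm p hp)]
  have hγr : retract a k γ = γ := by
    rw [hγ, map_mul, map_prod, retract_C]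
    congr 1
    exact Finset.prod_congr rfl fun p _ => by rw [map_pow, retract_lin_eq, red_red ha]
  -- All three restricted vectors are orthogonal to `a`, so Cramer's determinant vanishes; the
  -- common factors `π` and `a k` cancel.
  have hrel : b₂ • rvec a k τ₁ - b₁ • rvec a k τ₂ + γ • rvec a k X = 0 := by
    have hca : C (a k) ≠ (0 : S) := by simpa using ha
    have h := cramer_cross (rvec a k τ₁) (rvec a k τ₂) (rvec a k X) k
    rw [triple_product_permutation, triple_product_permutation, hcr, hΔ₂, ← cross_anticomm, hΔ₁,
      dotProduct_smul, dotProduct_comm _ (cvec a), dot_rvec_X ha, smul_zero, Pi.single_zero,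
      hb₁, hb₂, hπγ] at h
    ext1 i
    have h' := congrFun h i
    simp only [Pi.add_apply, Pi.sub_apply, Pi.smul_apply, Pi.neg_apply, smul_eq_mul,
      Pi.zero_apply, cvec] at h' ⊢
    apply mul_left_cancel₀ (mul_ne_zero hπ0 hca)
    linear_combination h'
  have hrp : IsRelPrime b₁ b₂ := isRelPrime_of_relation (k := k) hcT hPrel hu0 hua
    (fun p hp => by rw [← hπ, ← hb₁]; exact smul_cvec_cross_eq ha hΔ₁ _)
    (fun p hp => by rw [← hπ, ← hb₂]; exact smul_cvec_cross_eq ha hΔ₂ _) hY₁ hY₂ hrel hcr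
  -- the third generator
  have hφ : ∀ i, lin a ∣ b₂ * τ₁ i - b₁ * τ₂ i + γ * X i := fun i => by
    rw [← retract_eq_zero_iff (k := k) ha]
    have := congrFun hrel i
    simp only [Pi.add_apply, Pi.sub_apply, Pi.smul_apply, smul_eq_mul, Pi.zero_apply, rvec] at this
    rw [map_add, map_sub, map_mul, map_mul, map_mul, hb₁r, hb₂r, hγr, this]
  choose φ hφ using hφ
  have hφh : ∀ i, (φ i).IsHomogeneous (d₃ - 1 + 1) := by
    intro i
    refine isHomogeneous_of_mul (isHomogeneous_lin a) hα ?_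
    rw [← hφ i]
    refine ((?_ : IsHomogeneous _ _).sub ?_).add ?_
    · have := hn₂.mul (hτ₁ i)
      rwa [show e₂ + 2 - P.card + (e₁ + 1) = 1 + (d₃ - 1 + 1) by omega] at this
    · have := hn₁.mul (hτ₂ i)
      rwa [show e₁ + 2 - P.card + (e₂ + 1) = 1 + (d₃ - 1 + 1) by omega] at this
    · have hγh : γ.IsHomogeneous d₃ := by
        refine isHomogeneous_of_mul hπh hπ0 ?_
        rw [← hπγ, C_mul, mul_assoc, ← hrf, add_comm, hPcard]
        exact (isHomogeneous_retract hf).C_mul _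
      have := hγh.mul (isHomogeneous_X ℂ i)
      rwa [show d₃ + 1 = 1 + (d₃ - 1 + 1) by omega] at this
  have htφ : ∀ j ∈ s, lin (v j) ∣ cvec (v j) ⬝ᵥ φ := by
    intro j hj
    have h1 : lin a • φ = b₂ • τ₁ - b₁ • τ₂ + γ • (X : Fin 3 → S) := by
      ext1 i; exact (hφ i).symm
    have h2 : lin (v j) ∣ cvec (v j) ⬝ᵥ (lin a • φ) := by
      rw [h1, dotProduct_add, dotProduct_sub, dotProduct_smul, dotProduct_smul, dotProduct_smul]
      exact dvd_add (dvd_sub ((ht₁' j).mul_left _) ((ht₂' j).mul_left _))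
        ((tangent_X _).mul_left _)
    rw [dotProduct_smul, smul_eq_mul] at h2
    -- Division by `lin a` preserves tangency to the other lines, whose forms are coprime to it.
    exact (isRelPrime_lin (hv j i₀ (hne j hj))).dvd_of_dvd_mul_left h2
  -- projection to the syzygies of the gradient
  obtain ⟨h₁, hg₁, hρ₁⟩ := exists_sub_smul_X_dot_grad s hd0 hf hv0 (fun j _ => ht₁' j) hτ₁
  obtain ⟨h₂, hg₂, hρ₂⟩ := exists_sub_smul_X_dot_grad s hd0 hf hv0 (fun j _ => ht₂' j) hτ₂
  obtain ⟨h₃, hg₃, hρ₃⟩ := exists_sub_smul_X_dot_grad s hd0 hf hv0 htφ hφh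
  have hf0 : f ≠ 0 := Finset.prod_ne_zero_iff.2 fun j _ => lin_ne_zero (hv0 j)
  have hdC : (C (d : ℂ) : S) ≠ 0 := fun h => hd0 (by
    rw [← C_0] at h; exact_mod_cast C_injective _ _ h)
  have hdc : (d : ℂ) ≠ 0 := Nat.cast_ne_zero.2 hd0
  refine isPlusOneGeneratedCurve_of_relation (κ := c / d) (ρ₁ := τ₁ - h₁ • (X : Fin 3 → S))
    (ρ₂ := τ₂ - h₂ • (X : Fin 3 → S)) (φ := φ - h₃ • (X : Fin 3 → S)) (k := k) (a := a)
    hv hv0 hd₁ h₁₂ h₂₃ hd hf haf ha (div_ne_zero hc hdc) hg₁ hg₂ ?_ ?_ hrp hb₁r hb₂r hρ₁ hρ₂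
    (by rwa [Nat.sub_add_cancel (by omega)] at hρ₃) hn₁ hn₂ (by omega) (by omega) (by omega)
    (by omega)
  · have hw := hdetX τ₁ τ₂ h₁ h₂
    rw [hsaito'] at hw
    have hcr' : grad f ⨯₃ ((τ₁ - h₁ • (X : Fin 3 → S)) ⨯₃ (τ₂ - h₂ • (X : Fin 3 → S))) = 0 := by
      rw [cross_cross_eq_smul_sub_smul', dotProduct_comm (grad f), hg₁, hg₂]
      simp
    have h := smul_eq_of_cross_eq_zero hcr' X
    rw [dot_X_grad hf, hw] at h
    have hcd : (C c : S) = C (d : ℂ) * C (c / d) := by rw [← C_mul, mul_div_cancel₀ _ hdc]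
    ext1 i
    have h' := congrFun h i
    simp only [Pi.smul_apply, smul_eq_mul] at h' ⊢
    apply mul_left_cancel₀ (mul_ne_zero hdC hf0)
    rw [h', hcd, hfdef]; ring
  -- The difference is an Euler multiple annihilating `f`. Since the Euler field sends `f` to `d f ≠
  -- 0`, the multiple is zero.
  · have hw : lin a • (φ - h₃ • (X : Fin 3 → S)) - (b₂ • (τ₁ - h₁ • (X : Fin 3 → S)) -
        b₁ • (τ₂ - h₂ • (X : Fin 3 → S))) = (γ - lin a * h₃ + b₂ * h₁ - b₁ * h₂) • X := by
      ext1 i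
      simp only [Pi.sub_apply, Pi.smul_apply, smul_eq_mul]
      linear_combination -hφ i
    have h0 := congrArg (· ⬝ᵥ grad f) hw
    simp only [sub_dotProduct, smul_dotProduct, smul_eq_mul] at h0 hg₁ hg₂ hg₃
    rw [hg₁, hg₂, hg₃, dot_X_grad hf] at h0
    simp only [mul_zero, sub_zero] at h0
    rw [(mul_eq_zero.1 h0.symm).resolve_right (mul_ne_zero hdC hf0), zero_smul] at hw
    exact sub_eq_zero.1 hw

end Deletion

/-! ### Invariants, Hessians and equivariant vector fields -/

section Substitution

/-- The linear substitution `p(x) ↦ p(M x)`. -/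
noncomputable def subst (M : Matrix (Fin 3) (Fin 3) ℂ) : S →ₐ[ℂ] S :=
  aeval fun i => lin (M i)

variable {M N : Matrix (Fin 3) (Fin 3) ℂ}

theorem subst_X (i : Fin 3) : subst M (X i) = lin (M i) := aeval_X _ _

theorem subst_C (c : ℂ) : subst M (C c) = C c := by simp [subst, algebraMap_eq]

theorem subst_lin (w : Fin 3 → ℂ) : subst M (lin w) = lin (w ᵥ* M) := by
  conv_lhs => rw [lin]
  simp only [map_sum, map_mul, subst_C, subst_X, lin, vecMul, dotProduct, Finset.mul_sum,
    Finset.sum_mul]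
  rw [Finset.sum_comm]
  simp [mul_assoc]

theorem subst_one (p : S) : subst 1 p = p := by
  have : subst 1 = AlgHom.id ℂ S := by
    ext1 i
    rw [subst_X]
    simp [lin, Matrix.one_apply]
  rw [this]; rfl

theorem subst_mul (p : S) : subst (M * N) p = subst N (subst M p) := by
  have : subst (M * N) = (subst N).comp (subst M) := by
    ext1 i
    rw [AlgHom.comp_apply, subst_X, subst_X, subst_lin]
    rfl
  rw [this]; rfl

theorem pderiv_subst (p : S) (i : Fin 3) :
    pderiv i (subst M p) = ∑ j, C (M j i) * subst M (pderiv j p) := by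
  classical
  induction p using MvPolynomial.induction_on with
  | C c => simp
  | add p q hp hq => simp only [map_add, hp, hq, mul_add, Finset.sum_add_distrib]
  | mul_X p k hp =>
    have key : ∀ j, C (M j i) * subst M (pderiv j (p * X k)) =
        (if j = k then subst M p * C (M k i) else 0) +
          lin (M k) * (C (M j i) * subst M (pderiv j p)) := by
      intro j
      rw [Derivation.leibniz, smul_eq_mul, smul_eq_mul, map_add, map_mul, map_mul, subst_X]
      by_cases hj : j = k
      · subst hj
        rw [if_pos rfl, pderiv_X_self, map_one]; ring
      · rw [if_neg hj, pderiv_X_of_ne (Ne.symm hj), map_zero]; ring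
    rw [map_mul, Derivation.leibniz, hp, subst_X, pderiv_lin, Finset.sum_congr rfl fun j _ => key j,
      Finset.sum_add_distrib, Finset.sum_ite_eq', if_pos (Finset.mem_univ _), ← Finset.mul_sum,
      smul_eq_mul, smul_eq_mul]

/-- The Hessian matrix of a polynomial. -/
noncomputable def hess (f : S) : Matrix (Fin 3) (Fin 3) S :=
  Matrix.of fun i j => pderiv i (pderiv j f)

theorem grad_subst (p : S) : grad (subst M p) = (M.map C)ᵀ *ᵥ fun i => subst M (grad p i) := by
  ext1 i
  exact pderiv_subst p i

theorem hess_subst (p : S) :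
    hess (subst M p) = (M.map C)ᵀ * (hess p).map (subst M) * M.map C := by
  ext1 i j
  simp only [hess, of_apply, map_sum, pderiv_C_mul, pderiv_subst, mul_apply,
    transpose_apply, map_apply, Finset.mul_sum, Finset.sum_mul]
  exact Finset.sum_congr rfl fun k _ => Finset.sum_congr rfl fun l _ => by ring

/-- The substitution leaves `f` invariant. -/
def IsInvariant (M : Matrix (Fin 3) (Fin 3) ℂ) (f : S) : Prop := subst M f = f

theorem det_map_C : (M.map (C : ℂ → S)).det = C M.det := ((C : ℂ →+* S).map_det M).symm

theorem IsInvariant.det_hess {f : S} (hf : IsInvariant M f) (hM : M.det ^ 2 = 1) :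
    IsInvariant M (hess f).det := by
  have h := hess_subst (M := M) f
  rw [hf] at h
  have h1 : subst M (hess f).det = ((hess f).map (subst M)).det :=
    (subst M : S →+* S).map_det (hess f)
  have h2 := congrArg det h
  rw [det_mul, det_mul, det_transpose, det_map_C, ← h1] at h2
  have h3 : (C M.det : S) ^ 2 = 1 := by rw [← C_pow, hM, C_1]
  rw [IsInvariant]
  linear_combination (-subst M (hess f).det) * h3 - h2

/-- The vector field obtained from the gradient of `g` by means of the adjugate of the Hessian matrix
of `f`. -/
noncomputable def hessField (f g : S) : Fin 3 → S := (hess f).adjugate *ᵥ grad g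

/-- With `A` and `b` the substituted Hessian and gradient, `M adj(Mᵀ A M) Mᵀ b = det(M)² adj(A) b`,
and `det(M)² = 1`. -/
theorem hessField_equivariant {f g : S} (hf : IsInvariant M f) (hg : IsInvariant M g)
    (hM : M.det ^ 2 = 1) :
    M.map C *ᵥ hessField f g = fun i => subst M (hessField f g i) := by
  have h := hess_subst (M := M) f
  have h' := grad_subst (M := M) g
  rw [hf] at h
  rw [hg] at h'
  have hadj : (hess f).adjugate.map (subst M) = ((hess f).map (subst M)).adjugate :=
    (subst M : S →+* S).map_adjugate (hess f)
  have hrhs : (fun i => subst M (hessField f g i)) =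
      ((hess f).map (subst M)).adjugate *ᵥ fun i => subst M (grad g i) := by
    ext1 i
    rw [← hadj]
    simp [hessField, mulVec, dotProduct]
  have h3 : (C M.det : S) ^ 2 = 1 := by rw [← C_pow, hM, C_1]
  rw [hrhs, hessField]
  conv_lhs => rw [h, h']
  generalize (hess f).map (subst M) = A
  generalize (fun i => subst M (grad g i)) = b
  rw [adjugate_mul_distrib, adjugate_mul_distrib, mulVec_mulVec, mulVec_mulVec, ← mul_assoc,
    mul_adjugate, mul_assoc, mul_assoc, adjugate_mul, det_transpose, det_map_C, smul_mul_assoc,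
    one_mul, mul_smul_comm, mul_one, smul_smul, ← pow_two, h3, one_smul]

end Substitution

/-! ### Tangency of equivariant fields to mirrors -/

section Mirrors

variable {M : Matrix (Fin 3) (Fin 3) ℂ} {ℓ : Fin 3 → ℂ}

theorem exists_eq_add_smul (hℓ : ℓ ≠ 0) (h : ∀ x, ℓ ⬝ᵥ x = 0 → M *ᵥ x = x) :
    ∃ v : Fin 3 → ℂ, M = 1 + vecMulVec v ℓ := by
  obtain ⟨k, hk⟩ := Function.ne_iff.1 hℓ
  change ℓ k ≠ 0 at hk
  refine ⟨(ℓ k)⁻¹ • (M *ᵥ Pi.single k 1 - Pi.single k 1), ?_⟩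
  refine Matrix.ext_of_mulVec_single fun i => ?_
  have h1 := h (Pi.single i 1 - (ℓ i / ℓ k) • Pi.single k 1) (by
    simp [dotProduct_sub, hk])
  rw [mulVec_sub, mulVec_smul, sub_eq_iff_eq_add] at h1
  rw [h1, add_mulVec, one_mulVec, vecMulVec_mulVec]
  ext j
  simp
  ring

/-- An equivariant vector field is tangent to the mirrors. -/
theorem tangent_of_equivariant (hℓ : ℓ ≠ 0) (hM : M ≠ 1) (h : ∀ x, ℓ ⬝ᵥ x = 0 → M *ᵥ x = x)
    {θ : Fin 3 → S} (hθ : M.map C *ᵥ θ = fun i => subst M (θ i)) : lin ℓ ∣ cvec ℓ ⬝ᵥ θ := by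
  obtain ⟨v, rfl⟩ := exists_eq_add_smul hℓ h
  have hv : v ≠ 0 := by
    rintro rfl
    exact hM (by simp)
  -- The substitution is the identity on the mirror. Equivariance therefore gives `v i * (ℓ · θ) ≡
  -- 0` modulo `lin ℓ`, with some `v i` nonzero.
  have hsub : ∀ p : S, lin ℓ ∣ subst (1 + vecMulVec v ℓ) p - p := by
    intro p
    induction p using MvPolynomial.induction_on with
    | C c => simp
    | add p q hp hq =>
      rw [map_add, add_sub_add_comm]
      exact dvd_add hp hq
    | mul_X p i hp =>
      have hX : subst (1 + vecMulVec v ℓ) (X i) = X i + C (v i) * lin ℓ := by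
        rw [subst_X]
        simp [lin, vecMulVec_apply, Matrix.one_apply, add_mul, Finset.sum_add_distrib,
          Finset.mul_sum, mul_assoc]
      rw [map_mul, hX]
      have : subst (1 + vecMulVec v ℓ) p * (X i + C (v i) * lin ℓ) - p * X i =
          (subst (1 + vecMulVec v ℓ) p - p) * X i +
            lin ℓ * (subst (1 + vecMulVec v ℓ) p * C (v i)) := by ring
      rw [this]
      exact dvd_add (hp.mul_right _) (dvd_mul_right _ _)
  refine dvd_of_dvd_smul_cvec hv fun i => ?_
  have h1 := congrFun hθ i
  have h2 : ((1 + vecMulVec v ℓ).map C *ᵥ θ) i = θ i + C (v i) * (cvec ℓ ⬝ᵥ θ) := by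
    simp [mulVec, dotProduct, vecMulVec_apply, Matrix.one_apply, add_mul, Finset.sum_add_distrib,
          Finset.mul_sum, mul_assoc, cvec, apply_ite C]
  rw [h2] at h1
  have h3 := hsub (θ i)
  rw [← h1] at h3
  simpa [cvec, mul_comm] using h3

end Mirrors

/-! ### Degrees of Hessian fields -/

section Homogeneity

theorem isHomogeneous_hess {f : S} {d : ℕ} (hf : f.IsHomogeneous d) (i j : Fin 3) :
    (hess f i j).IsHomogeneous (d - 1 - 1) := hf.pderiv.pderiv

theorem isHomogeneous_det {A : Matrix (Fin 3) (Fin 3) S} {n : ℕ}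
    (hA : ∀ i j, (A i j).IsHomogeneous n) : A.det.IsHomogeneous (3 * n) := by
  rw [det_fin_three, show 3 * n = n + n + n by ring]
  have h := fun i j k l p q => ((hA i j).mul (hA k l)).mul (hA p q)
  exact (((((h _ _ _ _ _ _).sub (h _ _ _ _ _ _)).sub (h _ _ _ _ _ _)).add
    (h _ _ _ _ _ _)).add (h _ _ _ _ _ _)).sub (h _ _ _ _ _ _)

theorem isHomogeneous_adjugate {A : Matrix (Fin 3) (Fin 3) S} {n : ℕ}
    (hA : ∀ i j, (A i j).IsHomogeneous n) (i j : Fin 3) :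
    (A.adjugate i j).IsHomogeneous (n + n) := by
  have h : ∀ i j k l p q r s, (A i j * A k l - A p q * A r s).IsHomogeneous (n + n) :=
    fun i j k l p q r s => ((hA i j).mul (hA k l)).sub ((hA p q).mul (hA r s))
  have h' : ∀ i j k l p q r s, (-(A i j * A k l) + A p q * A r s).IsHomogeneous (n + n) :=
    fun i j k l p q r s => ((hA i j).mul (hA k l)).neg.add ((hA p q).mul (hA r s))
  rw [adjugate_fin_three]
  fin_cases i <;> fin_cases j
  exacts [h 1 1 2 2 1 2 2 1, h' 0 1 2 2 0 2 2 1, h 0 1 1 2 0 2 1 1, h' 1 0 2 2 1 2 2 0, h 0 0 2 2 0 2 2 0,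
    h' 0 0 1 2 0 2 1 0, h 1 0 2 1 1 1 2 0, h' 0 0 2 1 0 1 2 0, h 0 0 1 1 0 1 1 0]

theorem isHomogeneous_hessField {f g : S} {d e : ℕ} (hf : f.IsHomogeneous d)
    (hg : g.IsHomogeneous e) (i : Fin 3) :
    (hessField f g i).IsHomogeneous (d - 1 - 1 + (d - 1 - 1) + (e - 1)) :=
  isHomogeneous_dot (fun j => isHomogeneous_adjugate (isHomogeneous_hess hf) i j)
    (isHomogeneous_grad hg)

end Homogeneity

/-! ### Exact arithmetic in ℤ[τ, ω] -/

/-- The ring `ℤ[τ, ω]`, with elements `a + b τ + c ω + d τ ω`. -/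
@[ext]
structure K where
  a : ℤ
  b : ℤ
  c : ℤ
  d : ℤ
deriving DecidableEq

namespace K

instance : Zero K := ⟨⟨0, 0, 0, 0⟩⟩
instance : One K := ⟨⟨1, 0, 0, 0⟩⟩
instance : Add K := ⟨fun x y => ⟨x.a + y.a, x.b + y.b, x.c + y.c, x.d + y.d⟩⟩
instance : Neg K := ⟨fun x => ⟨-x.a, -x.b, -x.c, -x.d⟩⟩
instance : Sub K := ⟨fun x y => ⟨x.a - y.a, x.b - y.b, x.c - y.c, x.d - y.d⟩⟩
instance : Mul K := ⟨fun x y =>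
  ⟨x.a * y.a + x.b * y.b - x.c * y.c - x.d * y.d,
   x.a * y.b + x.b * y.a + x.b * y.b - x.c * y.d - x.d * y.c - x.d * y.d,
   x.a * y.c + x.b * y.d + x.c * y.a + x.d * y.b - x.c * y.c - x.d * y.d,
   x.a * y.d + x.b * y.c + x.b * y.d + x.c * y.b + x.d * y.a + x.d * y.b
     - x.c * y.d - x.d * y.c - x.d * y.d⟩⟩

theorem zero_def : (0 : K) = ⟨0, 0, 0, 0⟩ := rfl
theorem one_def : (1 : K) = ⟨1, 0, 0, 0⟩ := rfl
theorem add_def (x y : K) : x + y = ⟨x.a + y.a, x.b + y.b, x.c + y.c, x.d + y.d⟩ := rfl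
theorem neg_def (x : K) : -x = ⟨-x.a, -x.b, -x.c, -x.d⟩ := rfl
theorem sub_def (x y : K) : x - y = ⟨x.a - y.a, x.b - y.b, x.c - y.c, x.d - y.d⟩ := rfl
theorem mul_def (x y : K) : x * y =
  ⟨x.a * y.a + x.b * y.b - x.c * y.c - x.d * y.d,
   x.a * y.b + x.b * y.a + x.b * y.b - x.c * y.d - x.d * y.c - x.d * y.d,
   x.a * y.c + x.b * y.d + x.c * y.a + x.d * y.b - x.c * y.c - x.d * y.d,
   x.a * y.d + x.b * y.c + x.b * y.d + x.c * y.b + x.d * y.a + x.d * y.b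
     - x.c * y.d - x.d * y.c - x.d * y.d⟩ := rfl

instance : CommRing K where
  add_assoc _ _ _ := by simp only [add_def, mk.injEq]; refine ⟨?_, ?_, ?_, ?_⟩ <;> ring
  zero_add _ := by simp [add_def, zero_def]
  add_zero _ := by simp [add_def, zero_def]
  add_comm _ _ := by simp only [add_def, mk.injEq]; refine ⟨?_, ?_, ?_, ?_⟩ <;> ring
  left_distrib _ _ _ := by
    simp only [add_def, mul_def, mk.injEq]; refine ⟨?_, ?_, ?_, ?_⟩ <;> ring
  right_distrib _ _ _ := by
    simp only [add_def, mul_def, mk.injEq]; refine ⟨?_, ?_, ?_, ?_⟩ <;> ring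
  zero_mul _ := by simp [mul_def, zero_def]
  mul_zero _ := by simp [mul_def, zero_def]
  mul_assoc _ _ _ := by simp only [mul_def, mk.injEq]; refine ⟨?_, ?_, ?_, ?_⟩ <;> ring
  one_mul _ := by simp [mul_def, one_def]
  mul_one _ := by simp [mul_def, one_def]
  mul_comm _ _ := by simp only [mul_def, mk.injEq]; refine ⟨?_, ?_, ?_, ?_⟩ <;> ring
  neg_add_cancel _ := by simp [add_def, neg_def, zero_def]
  sub_eq_add_neg _ _ := by
    simp only [add_def, neg_def, sub_def, mk.injEq]; refine ⟨?_, ?_, ?_, ?_⟩ <;> ring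
  nsmul := nsmulRec
  zsmul := zsmulRec
  natCast n := ⟨n, 0, 0, 0⟩
  natCast_zero := rfl
  natCast_succ n := by simp [add_def, one_def]

end K

theorem τ_sq : τ ^ 2 = τ + 1 := by
  have h : ((Real.sqrt 5 : ℝ) : ℂ) ^ 2 = 5 := by
    rw [← Complex.ofReal_pow, Real.sq_sqrt (by norm_num)]; norm_num
  rw [τ]; linear_combination h / 4

theorem ω_sq : ω ^ 2 = -1 - ω := by
  have h : ((Real.sqrt 3 : ℝ) : ℂ) ^ 2 = 3 := by
    rw [← Complex.ofReal_pow, Real.sq_sqrt (by norm_num)]; norm_num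
  rw [ω]; linear_combination h * Complex.I ^ 2 / 4 + 3 / 4 * Complex.I_sq

theorem star_τ : star τ = τ := by
  simp [τ]

theorem star_ω : star ω = -1 - ω := by
  simp [ω]; ring

theorem inv_τ : τ⁻¹ = τ - 1 := by
  refine inv_eq_of_mul_eq_one_right ?_
  linear_combination τ_sq

/-- The embedding of `ℤ[τ, ω]` into `ℂ`. -/
noncomputable def toC : K →+* ℂ where
  toFun x := x.a + x.b * τ + x.c * ω + x.d * (τ * ω)
  map_one' := by simp [K.one_def]
  map_zero' := by simp [K.zero_def]
  map_add' x y := by simp only [K.add_def]; push_cast; ring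
  map_mul' x y := by
    simp only [K.mul_def]; push_cast
    linear_combination (-(x.b + x.d * ω) * (y.b + y.d * ω)) * τ_sq +
      (- x.c * y.c - (x.c * y.d + x.d * y.c) * τ - x.d * y.d * (τ + 1)) * ω_sq

theorem toC_mk (a b c d : ℤ) : toC ⟨a, b, c, d⟩ = a + b * τ + c * ω + d * (τ * ω) := rfl

theorem int_eq_zero_of_add_mul_sqrt_five {a b : ℤ} (h : (a : ℝ) + b * ((1 + Real.sqrt 5) / 2) = 0) :
    a = 0 ∧ b = 0 := by
  have hirr : Irrational (Real.sqrt 5) := by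
    have := Nat.Prime.irrational_sqrt (p := 5) (by norm_num)
    simpa using this
  have hb : b = 0 := by
    by_contra hb
    have hb' : (b : ℝ) ≠ 0 := by exact_mod_cast hb
    refine hirr ⟨-(2 * a + b) / b, ?_⟩
    push_cast
    field_simp
    linear_combination -2 * h
  subst hb
  refine ⟨?_, rfl⟩
  simpa using h

/-- The imaginary part isolates `c + d τ`, the real part then `a + b τ`, and √5 is irrational.
Injectivity carries computed inequalities over to `ℂ`. -/
theorem toC_injective : Function.Injective toC := by
  rw [injective_iff_map_eq_zero]
  rintro ⟨a, b, c, d⟩ h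
  rw [toC_mk] at h
  have hτ : τ = (((1 + Real.sqrt 5) / 2 : ℝ) : ℂ) := by simp [τ]
  have hω : ω = ((-1 / 2 : ℝ) : ℂ) + ((Real.sqrt 3 / 2 : ℝ) : ℂ) * Complex.I := by
    simp [ω]; ring
  rw [hτ] at h
  have him := congrArg Complex.im h
  have hre := congrArg Complex.re h
  rw [hω] at him hre
  generalize hs : (1 + Real.sqrt 5) / 2 = s at *
  simp at him hre
  have h3 : Real.sqrt 3 ≠ 0 := by positivity
  have h1 : (c : ℝ) + d * s = 0 := by
    have : Real.sqrt 3 * ((c : ℝ) + d * s) = 0 := by linear_combination 2 * him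
    exact (mul_eq_zero.1 this).resolve_left h3
  rw [← hs] at h1
  obtain ⟨rfl, rfl⟩ := int_eq_zero_of_add_mul_sqrt_five h1
  have h2 : (a : ℝ) + b * s = 0 := by simpa using hre
  rw [← hs] at h2
  obtain ⟨rfl, rfl⟩ := int_eq_zero_of_add_mul_sqrt_five h2
  rfl

/-! ### Computable formulas for determinants and their derivatives -/

section Multilinear

variable {R : Type*} [CommRing R]

/-- The explicit cross product. -/
def cr (u v : Fin 3 → R) : Fin 3 → R :=
  ![u 1 * v 2 - u 2 * v 1, u 2 * v 0 - u 0 * v 2, u 0 * v 1 - u 1 * v 0]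

/-- The explicit triple product. -/
def tri (u v w : Fin 3 → R) : R :=
  u 0 * (v 1 * w 2 - v 2 * w 1) + u 1 * (v 2 * w 0 - v 0 * w 2) + u 2 * (v 0 * w 1 - v 1 * w 0)

/-- The explicit dot product. -/
def dot3 (u v : Fin 3 → R) : R := u 0 * v 0 + u 1 * v 1 + u 2 * v 2

/-- The product of the adjugate of a matrix, given by its rows, and a vector. -/
def adjMul (A : Fin 3 → Fin 3 → R) (b : Fin 3 → R) : Fin 3 → R := fun i =>
  b 0 * cr (A 1) (A 2) i + b 1 * cr (A 2) (A 0) i + b 2 * cr (A 0) (A 1) i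

/-- The derivative of the determinant of a matrix. -/
def triDeriv (A B : Fin 3 → Fin 3 → R) : R :=
  tri (B 0) (A 1) (A 2) + tri (A 0) (B 1) (A 2) + tri (A 0) (A 1) (B 2)

/-- The mixed second derivative of the determinant of a matrix. -/
def triDeriv₂ (A B C D : Fin 3 → Fin 3 → R) : R :=
  tri (D 0) (A 1) (A 2) + tri (B 0) (C 1) (A 2) + tri (B 0) (A 1) (C 2) +
  (tri (C 0) (B 1) (A 2) + tri (A 0) (D 1) (A 2) + tri (A 0) (B 1) (C 2)) +
  (tri (C 0) (A 1) (B 2) + tri (A 0) (C 1) (B 2) + tri (A 0) (A 1) (D 2))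

end Multilinear

/-! ### Numerical data of the arrangement -/

/-- Coefficient vectors of equations of the 45 mirrors. -/
def form : Fin 45 → Fin 3 → K :=
  ![![⟨2, 0, 0, 0⟩, ⟨0, 0, 0, 0⟩, ⟨0, 0, 0, 0⟩], ![⟨0, 1, 0, 0⟩, ⟨1, -1, 0, 0⟩, ⟨-1, 0, 0, 0⟩],
    ![⟨1, 0, 0, 0⟩, ⟨-1, 1, -1, 1⟩, ⟨0, 0, 0, -1⟩], ![⟨0, -1, 0, 0⟩, ⟨1, -1, 0, 0⟩, ⟨-1, 0, 0,
    0⟩], ![⟨0, 0, 1, -1⟩, ⟨0, 0, 1, 0⟩, ⟨0, 0, 0, -1⟩], ![⟨-1, 0, 0, 0⟩, ⟨-1, 1, -1, 1⟩, ⟨0, 0, 0,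
    -1⟩], ![⟨-1, 1, -1, 1⟩, ⟨0, 0, 0, 1⟩, ⟨-1, 0, 0, 0⟩], ![⟨1, -1, 0, 0⟩, ⟨1, 0, 0, 0⟩, ⟨0, 1, 0,
    0⟩], ![⟨0, -1, 1, -1⟩, ⟨-1, 0, 0, 0⟩, ⟨0, 0, 1, 0⟩], ![⟨0, 0, -1, 1⟩, ⟨0, 0, 1, 0⟩, ⟨0, 0, 0,
    -1⟩], ![⟨0, 0, 0, 0⟩, ⟨0, 0, 2, 0⟩, ⟨0, 0, 0, 0⟩], ![⟨-1, 0, -1, 1⟩, ⟨-1, 1, 0, 1⟩, ⟨0, 0, 0,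
    0⟩], ![⟨1, -1, 1, -1⟩, ⟨0, 0, 0, 1⟩, ⟨-1, 0, 0, 0⟩], ![⟨-1, 1, 0, 0⟩, ⟨1, 0, 0, 0⟩, ⟨0, 1, 0,
    0⟩], ![⟨1, 0, 1, 0⟩, ⟨-1, 1, -1, 0⟩, ⟨0, 0, 1, 0⟩], ![⟨0, 1, -1, 1⟩, ⟨-1, 0, 0, 0⟩, ⟨0, 0, 1,
    0⟩], ![⟨-1, 0, -1, 0⟩, ⟨0, 0, 1, -1⟩, ⟨0, 1, 0, 0⟩], ![⟨0, 0, 1, 0⟩, ⟨0, 0, 0, 1⟩, ⟨0, 0, 1,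
    -1⟩], ![⟨1, 0, 1, -1⟩, ⟨-1, 1, 0, 1⟩, ⟨0, 0, 0, 0⟩], ![⟨0, 0, -1, 0⟩, ⟨1, 0, 1, 0⟩, ⟨-1, 1,
    -1, 0⟩], ![⟨-1, 0, -1, 0⟩, ⟨-1, 1, -1, 0⟩, ⟨0, 0, 1, 0⟩], ![⟨-1, 1, -1, 1⟩, ⟨0, 0, 0, -1⟩,
    ⟨-1, 0, 0, 0⟩], ![⟨0, 1, 0, 0⟩, ⟨-1, 0, -1, 0⟩, ⟨0, 0, 1, -1⟩], ![⟨1, 0, 1, 0⟩, ⟨0, 0, 1, -1⟩,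
    ⟨0, 1, 0, 0⟩], ![⟨0, 0, -1, 0⟩, ⟨0, 0, 0, 1⟩, ⟨0, 0, 1, -1⟩], ![⟨1, 0, 1, 0⟩, ⟨1, -1, 1, 0⟩,
    ⟨0, 0, 1, 0⟩], ![⟨-1, 1, -1, 0⟩, ⟨0, 0, 1, 0⟩, ⟨-1, 0, -1, 0⟩], ![⟨0, 0, 1, 0⟩, ⟨1, 0, 1, 0⟩,
    ⟨-1, 1, -1, 0⟩], ![⟨0, 1, 0, 0⟩, ⟨-1, 1, 0, 0⟩, ⟨-1, 0, 0, 0⟩], ![⟨1, -1, 1, -1⟩, ⟨0, 0, 0,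
    -1⟩, ⟨-1, 0, 0, 0⟩], ![⟨0, -1, 0, 0⟩, ⟨-1, 0, -1, 0⟩, ⟨0, 0, 1, -1⟩], ![⟨1, 0, 0, 0⟩, ⟨0, 0,
    1, 0⟩, ⟨0, -1, 1, -1⟩], ![⟨-1, 0, -1, 0⟩, ⟨1, -1, 1, 0⟩, ⟨0, 0, 1, 0⟩], ![⟨1, -1, 1, 0⟩, ⟨0,
    0, 1, 0⟩, ⟨-1, 0, -1, 0⟩], ![⟨0, 1, 1, 0⟩, ⟨0, 0, 0, 0⟩, ⟨-1, 1, 0, 1⟩], ![⟨0, -1, 0, 0⟩, ⟨-1,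
    1, 0, 0⟩, ⟨-1, 0, 0, 0⟩], ![⟨0, 0, 0, 0⟩, ⟨1, 0, 1, -1⟩, ⟨-1, 1, 0, 1⟩], ![⟨-1, 0, -1, 1⟩, ⟨0,
    0, 0, 0⟩, ⟨0, 1, 1, 0⟩], ![⟨-1, 0, 0, 0⟩, ⟨0, 0, 1, 0⟩, ⟨0, -1, 1, -1⟩], ![⟨0, 1, 0, 0⟩, ⟨1,
    0, 1, 0⟩, ⟨0, 0, 1, -1⟩], ![⟨0, 0, 0, 0⟩, ⟨-1, 0, -1, 1⟩, ⟨-1, 1, 0, 1⟩], ![⟨-1, 0, 0, 0⟩, ⟨0,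
    1, 0, 0⟩, ⟨-1, 1, 0, 0⟩], ![⟨0, -1, 0, 0⟩, ⟨1, 0, 1, 0⟩, ⟨0, 0, 1, -1⟩], ![⟨1, 0, 0, 0⟩, ⟨0,
    1, 0, 0⟩, ⟨-1, 1, 0, 0⟩], ![⟨0, 0, 0, 0⟩, ⟨0, 0, 0, 0⟩, ⟨0, 0, 2, 0⟩]]

/-- The three generating roots, scaled to norm 4. -/
def rootK : Fin 3 → Fin 3 → K :=
  ![![⟨2, 0, 0, 0⟩, ⟨0, 0, 0, 0⟩, ⟨0, 0, 0, 0⟩], ![⟨-1, 1, 0, 0⟩, ⟨1, 0, 0, 0⟩, ⟨0, 1, 0, 0⟩],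
    ![⟨1, 0, 0, 0⟩, ⟨0, 0, -1, 1⟩, ⟨0, -1, 0, -1⟩]]

/-- The complex conjugates of the three generating roots. -/
def conjRoot : Fin 3 → Fin 3 → K :=
  ![![⟨2, 0, 0, 0⟩, ⟨0, 0, 0, 0⟩, ⟨0, 0, 0, 0⟩], ![⟨-1, 1, 0, 0⟩, ⟨1, 0, 0, 0⟩, ⟨0, 1, 0, 0⟩],
    ![⟨1, 0, 0, 0⟩, ⟨1, -1, 1, -1⟩, ⟨0, 0, 0, 1⟩]]

/-- The sixth roots of unity. -/
def unitK : Fin 6 → K :=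
  ![⟨1, 0, 0, 0⟩, ⟨0, 0, 1, 0⟩, ⟨-1, 0, -1, 0⟩, ⟨-1, 0, 0, 0⟩, ⟨0, 0, -1, 0⟩, ⟨1, 0, 1, 0⟩]

/-- The permutations of the mirrors by the three generating reflections. -/
def perm : Fin 3 → Fin 45 → Fin 45 :=
  ![![0, 3, 5, 1, 9, 2, 12, 13, 15, 4, 10, 18, 6, 7, 20, 8, 23, 24, 11, 27, 14, 29, 30, 16, 17,
    32, 33, 19, 35, 21, 22, 38, 25, 26, 37, 28, 36, 34, 31, 42, 40, 43, 39, 41, 44], ![1, 0, 6, 7,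
    10, 11, 2, 3, 16, 17, 4, 5, 19, 13, 21, 22, 8, 9, 26, 12, 20, 14, 15, 25, 24, 23, 18, 33, 28,
    36, 37, 39, 34, 27, 32, 41, 29, 30, 40, 31, 38, 35, 42, 44, 43], ![2, 4, 0, 8, 1, 5, 10, 14,
    3, 15, 6, 13, 12, 11, 7, 9, 21, 25, 20, 28, 18, 16, 23, 22, 31, 17, 26, 34, 19, 30, 29, 24,
    38, 40, 27, 37, 41, 35, 32, 39, 33, 36, 44, 43, 42]]

/-- The scalars by which the three generating reflections permute the chosen equations. -/
def permUnit : Fin 3 → Fin 45 → Fin 6 :=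
  ![![3, 0, 0, 0, 0, 0, 0, 0, 0, 0, 0, 0, 0, 0, 0, 0, 0, 0, 0, 0, 0, 0, 0, 0, 0, 0, 0, 0, 0, 0, 0,
    0, 0, 0, 5, 0, 0, 4, 0, 0, 0, 0, 0, 0, 0], ![0, 0, 0, 0, 0, 0, 0, 0, 0, 0, 0, 0, 0, 3, 0, 0,
    0, 0, 0, 0, 0, 0, 0, 5, 0, 4, 0, 0, 0, 0, 0, 0, 2, 0, 1, 0, 0, 0, 2, 0, 1, 0, 0, 5, 4], ![0,
    0, 0, 0, 0, 3, 0, 0, 0, 0, 0, 1, 0, 2, 0, 0, 0, 0, 1, 0, 2, 0, 4, 5, 0, 0, 0, 0, 0, 5, 4, 0,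
    0, 0, 0, 5, 0, 4, 0, 0, 0, 0, 0, 0, 0]]

/-- Mirrors through the 16 intersection points on the first mirror. -/
def basePoints : Finset (Fin 45) :=
  {1, 2, 4, 6, 8, 10, 14, 16, 17, 19, 21, 25, 26, 31, 34, 41}

/-- A point on none of the mirrors. -/
def basePt : Fin 3 → K :=
  ![⟨1, 0, 0, 0⟩, ⟨1, 0, 0, 0⟩, ⟨2, 0, 0, 0⟩]

/-- The values of the 45 linear forms at the point `basePt`. -/
def formVal : Fin 45 → K :=
  ![⟨2, 0, 0, 0⟩, ⟨-1, 0, 0, 0⟩, ⟨0, 1, -1, -1⟩, ⟨-1, -2, 0, 0⟩, ⟨0, 0, 2, -3⟩, ⟨-2, 1, -1, -1⟩,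
    ⟨-3, 1, -1, 2⟩, ⟨2, 1, 0, 0⟩, ⟨-1, -1, 3, -1⟩, ⟨0, 0, 0, -1⟩, ⟨0, 0, 2, 0⟩, ⟨-2, 1, -1, 2⟩,
    ⟨-1, -1, 1, 0⟩, ⟨0, 3, 0, 0⟩, ⟨0, 1, 2, 0⟩, ⟨-1, 1, 1, 1⟩, ⟨-1, 2, 0, -1⟩, ⟨0, 0, 3, -1⟩, ⟨0,
    1, 1, 0⟩, ⟨-1, 2, -2, 0⟩, ⟨-2, 1, 0, 0⟩, ⟨-3, 1, -1, 0⟩, ⟨-1, 1, 1, -2⟩, ⟨1, 2, 2, -1⟩, ⟨0, 0,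
    1, -1⟩, ⟨2, -1, 4, 0⟩, ⟨-3, 1, -2, 0⟩, ⟨-1, 2, 0, 0⟩, ⟨-3, 2, 0, 0⟩, ⟨-1, -1, 1, -2⟩, ⟨-1, -1,
    1, -2⟩, ⟨1, -2, 3, -2⟩, ⟨0, -1, 2, 0⟩, ⟨-1, -1, 0, 0⟩, ⟨-2, 3, 1, 2⟩, ⟨-3, 0, 0, 0⟩, ⟨-1, 2,
    1, 1⟩, ⟨-1, 2, 1, 1⟩, ⟨-1, -2, 3, -2⟩, ⟨1, 1, 3, -2⟩, ⟨-3, 2, -1, 3⟩, ⟨-3, 3, 0, 0⟩, ⟨1, -1,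
    3, -2⟩, ⟨-1, 3, 0, 0⟩, ⟨0, 0, 4, 0⟩]

/-- The gradient of the sextic invariant at the point `basePt`. -/
def grad₁ : Fin 3 → K :=
  ![⟨51300, -8640, 13500, -2700⟩, ⟨31860, 5940, -10800, -2700⟩, ⟨66960, 5400, -5400, 10800⟩]

/-- The second derivatives of the sextic invariant at the point `basePt`. -/
def hess₁ : Fin 3 → Fin 3 → K :=
  ![![⟨53460, 6480, -8100, 8100⟩, ⟨56160, -15120, 15120, -30240⟩, ⟨73440, -17280, 30240, 4320⟩],
    ![⟨56160, -15120, 15120, -30240⟩, ⟨59940, 1620, 0, 8100⟩, ⟨21600, 21600, -34560, 4320⟩],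
    ![⟨73440, -17280, 30240, 4320⟩, ⟨21600, 21600, -34560, 4320⟩, ⟨119880, 11340, -11340, 22680⟩]]

/-- The third derivatives of the sextic invariant at the point `basePt`. -/
def third₁ : Fin 3 → Fin 3 → Fin 3 → K :=
  ![![![⟨15120, 45360, -64800, 32400⟩, ⟨69120, -19440, 23760, -25920⟩, ⟨64800, 0, 4320, 12960⟩],
    ![⟨69120, -19440, 23760, -25920⟩, ⟨51840, -6480, 2160, -25920⟩, ⟨51840, -17280, 17280,
    -34560⟩], ![⟨64800, 0, 4320, 12960⟩, ⟨51840, -17280, 17280, -34560⟩, ⟨88560, -25920, 49680,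
    19440⟩]], ![![⟨69120, -19440, 23760, -25920⟩, ⟨51840, -6480, 2160, -25920⟩, ⟨51840, -17280,
    17280, -34560⟩], ![⟨51840, -6480, 2160, -25920⟩, ⟨92880, -12960, 32400, 32400⟩, ⟨47520, 12960,
    -17280, 12960⟩], ![⟨51840, -17280, 17280, -34560⟩, ⟨47520, 12960, -17280, 12960⟩, ⟨-6480,
    45360, -69120, 19440⟩]], ![![⟨64800, 0, 4320, 12960⟩, ⟨51840, -17280, 17280, -34560⟩, ⟨88560,
    -25920, 49680, 19440⟩], ![⟨51840, -17280, 17280, -34560⟩, ⟨47520, 12960, -17280, 12960⟩,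
    ⟨-6480, 45360, -69120, 19440⟩], ![⟨88560, -25920, 49680, 19440⟩, ⟨-6480, 45360, -69120,
    19440⟩, ⟨198720, 12960, -12960, 25920⟩]]]

/-- The fourth derivatives of the sextic invariant at the point `basePt`. -/
def fourth₁ : Fin 3 → Fin 3 → Fin 3 → Fin 3 → K :=
  ![![![![⟨58320, 45360, -64800, 32400⟩, ⟨38880, -12960, 25920, 12960⟩, ⟨-25920, 51840, -77760,
    25920⟩], ![⟨38880, -12960, 25920, 12960⟩, ⟨64800, -10800, 10800, -21600⟩, ⟨51840, -17280,
    17280, -34560⟩], ![⟨-25920, 51840, -77760, 25920⟩, ⟨51840, -17280, 17280, -34560⟩, ⟨84240,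
    -17280, 36720, 23760⟩]], ![![⟨38880, -12960, 25920, 12960⟩, ⟨64800, -10800, 10800, -21600⟩,
    ⟨51840, -17280, 17280, -34560⟩], ![⟨64800, -10800, 10800, -21600⟩, ⟨-12960, 25920, -38880,
    12960⟩, ⟨51840, -17280, 17280, -34560⟩], ![⟨51840, -17280, 17280, -34560⟩, ⟨51840, -17280,
    17280, -34560⟩, ⟨25920, -8640, 8640, -17280⟩]], ![![⟨-25920, 51840, -77760, 25920⟩, ⟨51840,
    -17280, 17280, -34560⟩, ⟨84240, -17280, 36720, 23760⟩], ![⟨51840, -17280, 17280, -34560⟩,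
    ⟨51840, -17280, 17280, -34560⟩, ⟨25920, -8640, 8640, -17280⟩], ![⟨84240, -17280, 36720,
    23760⟩, ⟨25920, -8640, 8640, -17280⟩, ⟨77760, -25920, 51840, 25920⟩]]], ![![![⟨38880, -12960,
    25920, 12960⟩, ⟨64800, -10800, 10800, -21600⟩, ⟨51840, -17280, 17280, -34560⟩], ![⟨64800,
    -10800, 10800, -21600⟩, ⟨-12960, 25920, -38880, 12960⟩, ⟨51840, -17280, 17280, -34560⟩],
    ![⟨51840, -17280, 17280, -34560⟩, ⟨51840, -17280, 17280, -34560⟩, ⟨25920, -8640, 8640,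
    -17280⟩]], ![![⟨64800, -10800, 10800, -21600⟩, ⟨-12960, 25920, -38880, 12960⟩, ⟨51840, -17280,
    17280, -34560⟩], ![⟨-12960, 25920, -38880, 12960⟩, ⟨136080, -12960, 32400, 32400⟩, ⟨77760,
    -25920, 51840, 25920⟩], ![⟨51840, -17280, 17280, -34560⟩, ⟨77760, -25920, 51840, 25920⟩,
    ⟨6480, 41040, -60480, 23760⟩]], ![![⟨51840, -17280, 17280, -34560⟩, ⟨51840, -17280, 17280,
    -34560⟩, ⟨25920, -8640, 8640, -17280⟩], ![⟨51840, -17280, 17280, -34560⟩, ⟨77760, -25920,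
    51840, 25920⟩, ⟨6480, 41040, -60480, 23760⟩], ![⟨25920, -8640, 8640, -17280⟩, ⟨6480, 41040,
    -60480, 23760⟩, ⟨-25920, 51840, -77760, 25920⟩]]], ![![![⟨-25920, 51840, -77760, 25920⟩,
    ⟨51840, -17280, 17280, -34560⟩, ⟨84240, -17280, 36720, 23760⟩], ![⟨51840, -17280, 17280,
    -34560⟩, ⟨51840, -17280, 17280, -34560⟩, ⟨25920, -8640, 8640, -17280⟩], ![⟨84240, -17280,
    36720, 23760⟩, ⟨25920, -8640, 8640, -17280⟩, ⟨77760, -25920, 51840, 25920⟩]], ![![⟨51840,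
    -17280, 17280, -34560⟩, ⟨51840, -17280, 17280, -34560⟩, ⟨25920, -8640, 8640, -17280⟩],
    ![⟨51840, -17280, 17280, -34560⟩, ⟨77760, -25920, 51840, 25920⟩, ⟨6480, 41040, -60480,
    23760⟩], ![⟨25920, -8640, 8640, -17280⟩, ⟨6480, 41040, -60480, 23760⟩, ⟨-25920, 51840, -77760,
    25920⟩]], ![![⟨84240, -17280, 36720, 23760⟩, ⟨25920, -8640, 8640, -17280⟩, ⟨77760, -25920,
    51840, 25920⟩], ![⟨25920, -8640, 8640, -17280⟩, ⟨6480, 41040, -60480, 23760⟩, ⟨-25920, 51840,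
    -77760, 25920⟩], ![⟨77760, -25920, 51840, 25920⟩, ⟨-25920, 51840, -77760, 25920⟩, ⟨272160,
    6480, -6480, 12960⟩]]]]

/-- The gradient of the Hessian determinant at the point `basePt`. -/
def grad₂ : Fin 3 → K :=
  ![⟨-371819743200000, 894427012800000, -1063212674400000, 1218724120800000⟩, ⟨367095823200000,
    324297108000000, -155511446400000, 1218724120800000⟩, ⟨621667872000000, 1290291508800000,
    -1290291508800000, 2580583017600000⟩]

/-- The second derivatives of the Hessian determinant at the point `basePt`. -/
def hess₂ : Fin 3 → Fin 3 → K :=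
  ![![⟨-532338544800000, 1164918672000000, -2240413538400000, 1701036352800000⟩,
    ⟨-1341215366400000, 863816011200000, -863816011200000, 1727632022400000⟩, ⟨-1108231632000000,
    3904981228800000, -4295554934400000, 4988648476800000⟩], ![⟨-1341215366400000,
    863816011200000, -863816011200000, 1727632022400000⟩, ⟨1171957312800000, 536117680800000,
    539377185600000, 1701036352800000⟩, ⟨2103656054400000, 1083667248000000, -693093542400000,
    4988648476800000⟩], ![⟨-1108231632000000, 3904981228800000, -4295554934400000,
    4988648476800000⟩, ⟨2103656054400000, 1083667248000000, -693093542400000, 4988648476800000⟩,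
    ⟨2921461084800000, 4602279060000000, -4602279060000000, 9204558120000000⟩]]

/-- For roots of norm 4 a reflection subtracts half of a rank-one term; doubling keeps the identity
in ℤ[τ, ω]. -/
theorem form_perm : ∀ i j c, 2 * form j c - dot3 (form j) (rootK i) * conjRoot i c =
    2 * (unitK (permUnit i j) * form (perm i j) c) := by decide +kernel

theorem perm_perm : ∀ i j, perm i (perm i j) = j := by decide +kernel

/-- The numbering makes transitivity on the mirrors an instance of strong induction. -/
theorem exists_perm_eq : ∀ j, j ≠ 0 → ∃ i k, k < j ∧ perm i k = j := by decide +kernel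

theorem unitK_pow_six : ∀ n, unitK n ^ 6 = 1 := by decide +kernel

theorem cr_form_ne_zero : ∀ i j, i < j → ∃ c, cr (form i) (form j) c ≠ 0 := by decide +kernel

theorem basePoints_cover : ∀ j, j ≠ 0 → ∃ p ∈ basePoints, tri (form 0) (form p) (form j) = 0 := by
  decide +kernel

theorem basePoints_indep : ∀ p ∈ basePoints, ∀ q ∈ basePoints, p ≠ q →
    tri (form 0) (form p) (form q) ≠ 0 := by
  decide +kernel

theorem basePoints_card : basePoints.card = 16 := by decide +kernel

theorem zero_notMem_basePoints : 0 ∉ basePoints := by decide +kernel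

theorem formVal_eq : ∀ n, dot3 (form n) basePt = formVal n := by decide +kernel

/-- Derivatives of a sum of sixth powers. Orders up to four occur: the Hessian determinant takes
two, and its own Hessian two more. -/
theorem grad₁_eq : ∀ i, ∑ n, 6 * form n i * formVal n ^ 5 = grad₁ i := by
  decide +kernel

theorem hess₁_eq : ∀ i j, ∑ n, 30 * form n i * form n j * formVal n ^ 4 = hess₁ i j := by
  decide +kernel

theorem third₁_eq : ∀ i j k,
    ∑ n, 120 * form n i * form n j * form n k * formVal n ^ 3 = third₁ i j k := by
  decide +kernel

theorem fourth₁_eq : ∀ i j k l,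
    ∑ n, 360 * form n i * form n j * form n k * form n l * formVal n ^ 2 =
      fourth₁ i j k l := by
  decide +kernel

theorem grad₂_eq : ∀ k, triDeriv hess₁ (third₁ k) = grad₂ k := by decide +kernel

theorem hess₂_eq : ∀ k l, triDeriv₂ hess₁ (third₁ k) (third₁ l) (fourth₁ k l) = hess₂ k l := by
  decide +kernel

theorem tri_adjMul_ne_zero : tri basePt (adjMul hess₁ grad₂) (adjMul hess₂ grad₁) ≠ 0 := by
  decide +kernel

/-! ### The generating reflections over ℤ[τ, ω] -/

section Generators

theorem dot_conjRoot (i : Fin 3) : dot3 (conjRoot i) (rootK i) = 4 := by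
  revert i; decide +kernel

theorem reflectionMatrix_eq {v v' : Fin 3 → ℂ} {s : ℂ} {x y : Fin 3 → K} (hs : s ≠ 0)
    (hv : star v = v') (hv' : v' 0 * v 0 + v' 1 * v 1 + v' 2 * v 2 = 4 / s ^ 2)
    (hx : ∀ c, toC (x c) = s * v c) (hy : ∀ c, toC (y c) = s * v' c) :
    reflectionMatrix v =
      1 - (1 / 2 : ℂ) • vecMulVec (fun c => toC (x c)) fun c => toC (y c) := by
  rw [show (fun c => toC (x c)) = s • v from funext hx,
    show (fun c => toC (y c)) = s • v' from funext hy, reflectionMatrix, hv, dot_expand, hv',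
    smul_vecMulVec, vecMulVec_smul, smul_smul, smul_smul]
  congr 2
  field_simp
  norm_num

theorem reflectionMatrix_wimanRoot (i : Fin 3) : reflectionMatrix (wimanRoot i) =
    1 - (1 / 2 : ℂ) • vecMulVec (fun c => toC (rootK i c)) fun c => toC (conjRoot i c) := by
  have h₁ : wimanRoot 1 = ![τ - 1, 1, τ] := by simp [wimanRoot, inv_τ]
  have h₂ : wimanRoot 2 = ![1, ω * (τ - 1), (-1 - ω) * τ] := by simp [wimanRoot, inv_τ, ω_sq]
  have hstar : star (-1 - ω) = ω := by
    rw [star_sub, star_neg, star_one, star_ω]; ring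
  fin_cases i
  · refine reflectionMatrix_eq (v' := ![1, 0, 0]) (s := 2) two_ne_zero ?_ ?_ ?_ ?_
    · ext c; fin_cases c <;> simp [wimanRoot]
    · change (1 : ℂ) * 1 + 0 * 0 + 0 * 0 = 4 / 2 ^ 2
      norm_num
    · intro c; fin_cases c <;> simp [wimanRoot, rootK, toC_mk]
    · intro c; fin_cases c <;> simp [conjRoot, toC_mk]
  · change reflectionMatrix (wimanRoot 1) = _
    rw [h₁]
    refine reflectionMatrix_eq (v' := ![τ - 1, 1, τ]) one_ne_zero ?_ ?_ ?_ ?_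
    · ext c
      fin_cases c
      exacts [by simpa using star_τ, star_one _, star_τ]
    · simp only [cons_val]
      linear_combination 2 * τ_sq
    · intro c; fin_cases c <;> simp [rootK, toC_mk]; ring
    · intro c; fin_cases c <;> simp [conjRoot, toC_mk]; ring
  · change reflectionMatrix (wimanRoot 2) = _
    rw [h₂]
    refine reflectionMatrix_eq (v' := ![1, (-1 - ω) * (τ - 1), ω * τ]) one_ne_zero ?_ ?_ ?_ ?_
    · ext c
      fin_cases c
      · exact star_one _
      · change star (ω * (τ - 1)) = (-1 - ω) * (τ - 1)
        rw [star_mul, star_sub, star_τ, star_ω, star_one, mul_comm]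
      · change star ((-1 - ω) * τ) = ω * τ
        rw [star_mul, star_τ, hstar, mul_comm]
    · simp only [cons_val]
      linear_combination (-(τ - 1) ^ 2 - τ ^ 2) * ω_sq + 2 * τ_sq
    · intro c; fin_cases c <;> simp [rootK, toC_mk] <;> ring
    · intro c; fin_cases c <;> simp [conjRoot, toC_mk] <;> ring

end Generators

/-! ### The invariants and the nonvanishing Jacobian -/

section Jacobian

/-- The coefficient vectors of the 45 mirrors. -/
noncomputable def mirror (j : Fin 45) : Fin 3 → ℂ := fun c => toC (form j c)

/-- The invariant of degree six. -/
noncomputable def sextic : S := ∑ n, lin (mirror n) ^ 6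

theorem isHomogeneous_sextic : sextic.IsHomogeneous 6 :=
  IsHomogeneous.sum _ _ _ fun n _ => by simpa using (isHomogeneous_lin (mirror n)).pow 6

theorem map_dot3 {R R' : Type*} [CommRing R] [CommRing R'] (g : R →+* R') (u v : Fin 3 → R) :
    g (dot3 u v) = (fun j => g (u j)) ⬝ᵥ fun j => g (v j) := by
  simp [dot3, dot_expand]

theorem map_tri {R R' : Type*} [CommRing R] [CommRing R'] (g : R →+* R') (u v w : Fin 3 → R) :
    g (tri u v w) = tri (fun j => g (u j)) (fun j => g (v j)) fun j => g (w j) := by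
  simp [tri]

theorem map_adjMul {R R' : Type*} [CommRing R] [CommRing R'] (g : R →+* R')
    (A : Fin 3 → Fin 3 → R) (b : Fin 3 → R) (i : Fin 3) :
    g (adjMul A b i) = adjMul (fun i j => g (A i j)) (fun j => g (b j)) i := by
  fin_cases i <;> simp [adjMul, cr]

theorem dot_cross_eq_tri {R : Type*} [CommRing R] (u v w : Fin 3 → R) : u ⬝ᵥ v ⨯₃ w = tri u v w := by
  simp only [dot_expand, cross_apply, tri, cons_val]

theorem adjugate_mulVec {R : Type*} [CommRing R] (A : Matrix (Fin 3) (Fin 3) R) (b : Fin 3 → R) :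
    A.adjugate *ᵥ b = adjMul (fun i j => A i j) b := by
  ext i
  rw [adjugate_fin_three, mulVec, dot_expand]
  fin_cases i <;> simp [adjMul, cr] <;> ring

/-- The point at which the Jacobian is evaluated. -/
noncomputable def pt : Fin 3 → ℂ := fun c => toC (basePt c)

theorem eval_lin_mirror (n : Fin 45) : eval pt (lin (mirror n)) = toC (formVal n) := by
  rw [eval_lin, ← formVal_eq, map_dot3]; rfl

/-- Arbitrary coefficients keep the shape stable under differentiation, so the rule can be iterated.
-/
theorem pderiv_sum_pow (c : Fin 45 → ℂ) (m : ℕ) (i : Fin 3) :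
    pderiv i (∑ n, C (c n) * lin (mirror n) ^ (m + 1)) =
      ∑ n, C ((m + 1) * c n * mirror n i) * lin (mirror n) ^ m := by
  rw [map_sum]
  refine Finset.sum_congr rfl fun n _ => ?_
  rw [pderiv_C_mul, pderiv_pow, pderiv_lin]
  simp only [C_mul, C_add, C_1, map_natCast, Nat.add_sub_cancel]
  push_cast
  ring

theorem sextic_eq : sextic = ∑ n, C (1 : ℂ) * lin (mirror n) ^ (5 + 1) := by
  simp [sextic]

theorem eval_grad_sextic (i : Fin 3) : eval pt (grad sextic i) = toC (grad₁ i) := by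
  rw [grad, sextic_eq, pderiv_sum_pow, ← grad₁_eq, map_sum, map_sum]
  refine Finset.sum_congr rfl fun n _ => ?_
  simp only [map_mul, map_pow, eval_C, eval_lin_mirror, mirror, map_ofNat]
  push_cast
  ring

theorem eval_hess_sextic (i j : Fin 3) : eval pt (hess sextic i j) = toC (hess₁ i j) := by
  rw [hess, of_apply, sextic_eq, pderiv_sum_pow, pderiv_sum_pow, ← hess₁_eq, map_sum, map_sum]
  refine Finset.sum_congr rfl fun n _ => ?_
  simp only [map_mul, map_pow, eval_C, eval_lin_mirror, mirror, map_ofNat]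
  push_cast
  ring

theorem eval_third_sextic (k i j : Fin 3) :
    eval pt (pderiv k (hess sextic i j)) = toC (third₁ k i j) := by
  rw [hess, of_apply, sextic_eq, pderiv_sum_pow, pderiv_sum_pow, pderiv_sum_pow, ← third₁_eq,
    map_sum, map_sum]
  refine Finset.sum_congr rfl fun n _ => ?_
  simp only [map_mul, map_pow, eval_C, eval_lin_mirror, mirror, map_ofNat]
  push_cast
  ring

theorem eval_fourth_sextic (l k i j : Fin 3) :
    eval pt (pderiv l (pderiv k (hess sextic i j))) = toC (fourth₁ k l i j) := by
  rw [hess, of_apply, sextic_eq, pderiv_sum_pow, pderiv_sum_pow, pderiv_sum_pow, pderiv_sum_pow,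
    ← fourth₁_eq, map_sum, map_sum]
  refine Finset.sum_congr rfl fun n _ => ?_
  simp only [map_mul, map_pow, eval_C, eval_lin_mirror, mirror, map_ofNat]
  push_cast
  ring

theorem det_eq_tri {R : Type*} [CommRing R] (A : Matrix (Fin 3) (Fin 3) R) :
    A.det = tri (fun j => A 0 j) (fun j => A 1 j) fun j => A 2 j := by
  rw [det_fin_three, tri]; ring

theorem pderiv_tri (k : Fin 3) (u v w : Fin 3 → S) :
    pderiv k (tri u v w) = tri (fun j => pderiv k (u j)) v w + tri u (fun j => pderiv k (v j)) w +
      tri u v fun j => pderiv k (w j) := by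
  simp only [tri, map_add, map_sub, Derivation.leibniz, smul_eq_mul]
  ring

theorem pderiv_det (k : Fin 3) (A : Matrix (Fin 3) (Fin 3) S) :
    pderiv k A.det = triDeriv (fun i j => A i j) fun i j => pderiv k (A i j) := by
  rw [det_eq_tri, pderiv_tri, triDeriv]

theorem pderiv_triDeriv (l : Fin 3) (A B : Fin 3 → Fin 3 → S) :
    pderiv l (triDeriv A B) =
      triDeriv₂ A B (fun i j => pderiv l (A i j)) fun i j => pderiv l (B i j) := by
  simp only [triDeriv, map_add, pderiv_tri, triDeriv₂]

/-- The invariant of degree twelve. -/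
noncomputable def dodecic : S := (hess sextic).det

theorem isHomogeneous_dodecic : dodecic.IsHomogeneous 12 :=
  isHomogeneous_det (isHomogeneous_hess isHomogeneous_sextic)

theorem eval_grad_dodecic (k : Fin 3) : eval pt (grad dodecic k) = toC (grad₂ k) := by
  rw [grad, dodecic, pderiv_det, ← grad₂_eq]
  simp only [triDeriv, map_add, map_tri, eval_hess_sextic, eval_third_sextic]

theorem eval_hess_dodecic (l k : Fin 3) : eval pt (hess dodecic l k) = toC (hess₂ k l) := by
  rw [hess, of_apply, dodecic, pderiv_det, pderiv_triDeriv, ← hess₂_eq]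
  simp only [triDeriv₂, map_add, map_tri, eval_hess_sextic, eval_third_sextic, eval_fourth_sextic]

theorem hess₂_symm (k l : Fin 3) : hess₂ k l = hess₂ l k := by
  revert k l; decide +kernel

/-- The determinant of the three basic derivations. -/
noncomputable def jacobian : S :=
  X ⬝ᵥ hessField sextic dodecic ⨯₃ hessField dodecic sextic

theorem isHomogeneous_hessField₁ (i : Fin 3) : (hessField sextic dodecic i).IsHomogeneous 19 :=
  isHomogeneous_hessField isHomogeneous_sextic isHomogeneous_dodecic i

theorem isHomogeneous_hessField₂ (i : Fin 3) : (hessField dodecic sextic i).IsHomogeneous 25 :=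
  isHomogeneous_hessField isHomogeneous_dodecic isHomogeneous_sextic i

theorem isHomogeneous_jacobian : jacobian.IsHomogeneous 45 :=
  isHomogeneous_dot (fun i => isHomogeneous_X _ i)
    (isHomogeneous_cross isHomogeneous_hessField₁ isHomogeneous_hessField₂)

theorem eval_jacobian : eval pt jacobian =
    toC (tri basePt (adjMul hess₁ grad₂) (adjMul hess₂ grad₁)) := by
  simp only [jacobian, dot_cross_eq_tri, hessField, adjugate_mulVec, map_tri, map_adjMul,
    eval_hess_sextic, eval_hess_dodecic, eval_grad_sextic, eval_grad_dodecic, eval_X]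
  simp only [hess₂_symm, pt]

theorem jacobian_ne_zero : jacobian ≠ 0 := fun h => by
  have h1 := eval_jacobian
  rw [h, map_zero] at h1
  exact tri_adjMul_ne_zero (toC_injective (h1.symm.trans (map_zero toC).symm))

end Jacobian

/-! ### Invariance under the group -/

section Group

/-- The generating reflections. -/
noncomputable def gen (i : Fin 3) : Matrix (Fin 3) (Fin 3) ℂ := reflectionMatrix (wimanRoot i)

theorem vecMul_gen (i : Fin 3) (w : Fin 3 → ℂ) : w ᵥ* gen i =
    w - ((1 / 2 : ℂ) * (w ⬝ᵥ fun c => toC (rootK i c))) • fun c => toC (conjRoot i c) := by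
  rw [gen, reflectionMatrix_wimanRoot, vecMul_sub, vecMul_one, vecMul_smul, vecMul_vecMulVec,
    smul_smul]

theorem mirror_vecMul_gen (i : Fin 3) (j : Fin 45) :
    mirror j ᵥ* gen i = toC (unitK (permUnit i j)) • mirror (perm i j) := by
  rw [vecMul_gen]
  ext c
  have h := congrArg toC (form_perm i j c)
  simp only [map_sub, map_mul, map_dot3, map_ofNat] at h
  change 2 * mirror j c - (mirror j ⬝ᵥ fun c => toC (rootK i c)) * _ = 2 * (_ * mirror _ c) at h
  simp only [Pi.sub_apply, Pi.smul_apply, smul_eq_mul]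
  linear_combination h / 2

theorem gen_mul_self (i : Fin 3) : gen i * gen i = 1 := by
  refine Matrix.ext_of_single_vecMul fun k => ?_
  have h := congrArg toC (dot_conjRoot i)
  rw [map_dot3, map_ofNat] at h
  rw [← vecMul_vecMul, vecMul_gen, vecMul_gen, sub_dotProduct, smul_dotProduct, h, vecMul_one,
    sub_sub, ← add_smul, smul_eq_mul]
  generalize (Pi.single k 1 ⬝ᵥ fun c => toC (rootK i c)) = t
  rw [show 1 / 2 * t + 1 / 2 * (t - 1 / 2 * t * 4) = 0 by ring, zero_smul, sub_zero]

theorem det_gen_sq (i : Fin 3) : (gen i).det ^ 2 = 1 := by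
  rw [pow_two, ← det_mul, gen_mul_self, det_one]

theorem toC_unitK_pow_six (n : Fin 6) : toC (unitK n) ^ 6 = 1 := by
  rw [← map_pow, unitK_pow_six, map_one]

theorem toC_unitK_ne_zero (n : Fin 6) : toC (unitK n) ≠ 0 := fun h => by
  have := toC_unitK_pow_six n
  simp [h] at this

/-- A generator permutes the 45 forms up to sixth roots of unity, which the sixth powers absorb. -/
theorem sextic_invariant (i : Fin 3) : IsInvariant (gen i) sextic := by
  have hinv : Function.Involutive (perm i) := perm_perm i
  rw [IsInvariant, sextic, map_sum, ← Equiv.sum_comp hinv.toPerm fun n => lin (mirror n) ^ 6]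
  refine Finset.sum_congr rfl fun n _ => ?_
  rw [map_pow, subst_lin, mirror_vecMul_gen, lin_smul, mul_pow, ← C_pow, toC_unitK_pow_six, C_1,
    one_mul]
  rfl

theorem invariant_of_mem {g : GL (Fin 3) ℂ} (hg : g ∈ wimanGroup) :
    IsInvariant (g : Matrix (Fin 3) (Fin 3) ℂ) sextic ∧
      (g : Matrix (Fin 3) (Fin 3) ℂ).det ^ 2 = 1 := by
  induction hg using Subgroup.closure_induction with
  | mem g h =>
    obtain ⟨i, hi⟩ := h
    rw [hi]
    exact ⟨sextic_invariant i, det_gen_sq i⟩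
  | one => exact ⟨subst_one _, by simp⟩
  | mul g h _ _ hg hh =>
    refine ⟨?_, ?_⟩
    · rw [IsInvariant, Units.val_mul, subst_mul, hg.1, hh.1]
    · rw [Units.val_mul, det_mul, mul_pow, hg.2, hh.2, one_mul]
  | inv g _ hg =>
    refine ⟨?_, ?_⟩
    · have h := subst_mul (M := (g : Matrix (Fin 3) (Fin 3) ℂ)) (N := ((g⁻¹ : GL (Fin 3) ℂ) :
        Matrix (Fin 3) (Fin 3) ℂ)) sextic
      rw [hg.1, ← Units.val_mul, mul_inv_cancel, Units.val_one, subst_one] at h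
      exact h.symm
    · have h : ((g : Matrix (Fin 3) (Fin 3) ℂ) * ((g⁻¹ : GL (Fin 3) ℂ) :
        Matrix (Fin 3) (Fin 3) ℂ)).det ^ 2 = 1 := by
        rw [← Units.val_mul, mul_inv_cancel, Units.val_one, det_one, one_pow]
      rwa [det_mul, mul_pow, hg.2, one_mul] at h

/-- The basic derivations are tangent to the mirrors of the group. -/
theorem tangent_of_mem {ℓ : ProjLine} (hℓ : ℓ ∈ wimanArrangement) :
    lin ℓ.rep ∣ cvec ℓ.rep ⬝ᵥ hessField sextic dodecic ∧
      lin ℓ.rep ∣ cvec ℓ.rep ⬝ᵥ hessField dodecic sextic := by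
  obtain ⟨g, hg, hg1, h⟩ := hℓ
  obtain ⟨h₁, h₂⟩ := invariant_of_mem hg
  have h₃ : IsInvariant (g : Matrix (Fin 3) (Fin 3) ℂ) dodecic := h₁.det_hess h₂
  have hne : (g : Matrix (Fin 3) (Fin 3) ℂ) ≠ 1 := fun h => hg1 (Units.ext h)
  exact ⟨tangent_of_equivariant ℓ.rep_nonzero hne h (hessField_equivariant h₁ h₃ h₂),
    tangent_of_equivariant ℓ.rep_nonzero hne h (hessField_equivariant h₃ h₁ h₂)⟩

theorem lin_dvd_jacobian {ℓ : ProjLine} (hℓ : ℓ ∈ wimanArrangement) : lin ℓ.rep ∣ jacobian :=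
  dvd_triple_of_tangent ℓ.rep_nonzero (tangent_X _) (tangent_of_mem hℓ).1 (tangent_of_mem hℓ).2

end Group

/-! ### Saito's criterion and the list of mirrors -/

section Lines

theorem mirror_cross_ne_zero {i j : Fin 45} (h : i ≠ j) : mirror i ⨯₃ mirror j ≠ 0 := by
  have key : ∀ i j : Fin 45, i < j → mirror i ⨯₃ mirror j ≠ 0 := by
    intro i j hij h0
    obtain ⟨c, hc⟩ := cr_form_ne_zero i j hij
    apply hc
    apply toC_injective
    rw [map_zero]
    exact (map_cross toC (form i) (form j) c).trans (congrFun h0 c)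
  rcases lt_or_gt_of_ne h with h | h
  · exact key i j h
  · rw [← cross_anticomm]
    exact neg_ne_zero.2 (key j i h)

theorem mirror_ne_zero (j : Fin 45) : mirror j ≠ 0 := by
  obtain ⟨i, hi⟩ : ∃ i : Fin 45, i ≠ j := exists_ne j
  intro h
  have := mirror_cross_ne_zero hi
  rw [h, map_zero] at this
  exact this rfl

/-- The 45 mirrors as points of the dual projective plane. -/
noncomputable def line (j : Fin 45) : ProjLine := Projectivization.mk ℂ (mirror j) (mirror_ne_zero j)

theorem exists_rep_line (j : Fin 45) : ∃ s : ℂ, s ≠ 0 ∧ (line j).rep = s • mirror j := by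
  obtain ⟨s, hs⟩ := Projectivization.exists_smul_eq_mk_rep ℂ (mirror j) (mirror_ne_zero j)
  exact ⟨s, s.ne_zero, hs.symm⟩

theorem exists_reflection (j : Fin 45) : ∃ g ∈ wimanGroup, g ≠ 1 ∧
    ∀ x : Fin 3 → ℂ, mirror j ⬝ᵥ x = 0 → (g : Matrix (Fin 3) (Fin 3) ℂ) *ᵥ x = x := by
  have hmem : ∀ i, (⟨gen i, gen i, gen_mul_self i, gen_mul_self i⟩ : GL (Fin 3) ℂ) ∈ wimanGroup :=
    fun i => Subgroup.subset_closure ⟨i, rfl⟩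
  induction j using WellFoundedLT.induction with
  | ind j ih =>
  by_cases hj : j = 0
  · subst hj
    have hroot : (fun c => toC (conjRoot 0 c)) = mirror 0 := rfl
    have hgen : ∀ x, gen 0 *ᵥ x =
        x - ((1 / 2 : ℂ) * (mirror 0 ⬝ᵥ x)) • fun c => toC (rootK 0 c) := by
      intro x
      rw [gen, reflectionMatrix_wimanRoot, sub_mulVec, one_mulVec, smul_mulVec, vecMulVec_mulVec,
        hroot]
      ext c
      simp
      ring
    refine ⟨_, hmem 0, fun h => ?_, fun x hx => ?_⟩
    · have h1 : gen 0 = 1 := congrArg Units.val h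
      have h2 := hgen (Pi.single 0 1)
      rw [h1, one_mulVec, eq_comm, sub_eq_self] at h2
      have h3 := congrFun h2 0
      simp [mirror, form, rootK, toC_mk] at h3
    · change gen 0 *ᵥ x = x
      rw [hgen, hx]; simp
  · obtain ⟨i, k, hk, rfl⟩ := exists_perm_eq j hj
    obtain ⟨g, hg, hg1, h⟩ := ih k hk
    set s : GL (Fin 3) ℂ := ⟨gen i, gen i, gen_mul_self i, gen_mul_self i⟩ with hs
    have hss : s * s = 1 := Units.ext (gen_mul_self i)
    -- Conjugation by the involution `s` carries the mirror `k` to the mirror `perm i k`.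
    refine ⟨s * g * s, mul_mem (mul_mem (hmem i) hg) (hmem i), fun h1 => hg1 ?_, fun x hx => ?_⟩
    · calc g = s * s * g * (s * s) := by rw [hss]; simp
        _ = s * (s * g * s) * s := by simp only [mul_assoc]
        _ = 1 := by rw [h1, mul_one, hss]
    · have h0 : mirror k ⬝ᵥ (gen i *ᵥ x) = 0 := by
        rw [dotProduct_mulVec, mirror_vecMul_gen, smul_dotProduct, hx, smul_zero]
      change (gen i * (g : Matrix (Fin 3) (Fin 3) ℂ) * gen i) *ᵥ x = x
      rw [← mulVec_mulVec, ← mulVec_mulVec, h _ h0, mulVec_mulVec, gen_mul_self, one_mulVec]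

theorem line_mem (j : Fin 45) : line j ∈ wimanArrangement := by
  obtain ⟨g, hg, hg1, h⟩ := exists_reflection j
  obtain ⟨s, hs, hrep⟩ := exists_rep_line j
  refine ⟨g, hg, hg1, fun x hx => h x ?_⟩
  rw [hrep, smul_dotProduct] at hx
  exact (smul_eq_zero.1 hx).resolve_left hs

theorem line_cross_ne_zero (i j : Fin 45) (h : i ≠ j) : (line i).rep ⨯₃ (line j).rep ≠ 0 := by
  obtain ⟨s, hs, hi⟩ := exists_rep_line i
  obtain ⟨t, ht, hj⟩ := exists_rep_line j
  rw [hi, hj, map_smul, map_smul, LinearMap.smul_apply]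
  exact smul_ne_zero ht (smul_ne_zero hs (mirror_cross_ne_zero h))

theorem line_injective : Function.Injective line := by
  intro i j h
  by_contra hij
  apply line_cross_ne_zero i j hij
  rw [h, cross_self]

theorem eq_of_rep_cross_eq_zero {ℓ m : ProjLine} (h : ℓ.rep ⨯₃ m.rep = 0) : ℓ = m := by
  obtain ⟨i, hi⟩ := Function.ne_iff.1 ℓ.rep_nonzero
  obtain ⟨j, hj⟩ := Function.ne_iff.1 m.rep_nonzero
  have h1 := smul_eq_of_cross_eq_zero h (Pi.single i 1)
  simp only [single_dotProduct, one_mul] at h1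
  rw [← ℓ.mk_rep, ← m.mk_rep, Projectivization.mk_eq_mk_iff']
  have hm : m.rep i ≠ 0 := by
    intro h0
    rw [h0, zero_smul] at h1
    exact (smul_ne_zero hi m.rep_nonzero) h1
  refine ⟨(m.rep i)⁻¹ * ℓ.rep i, ?_⟩
  rw [mul_smul, h1, smul_smul, inv_mul_cancel₀ hm, one_smul]

/-- Saito's criterion for the 45 mirrors. -/
theorem exists_jacobian_eq : ∃ c : ℂ, c ≠ 0 ∧ jacobian = C c * ∏ j, lin (line j).rep := by
  obtain ⟨q, hq⟩ : ∏ j, lin (line j).rep ∣ jacobian :=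
    Finset.prod_dvd_of_isRelPrime
      (pairwise_isRelPrime_lin (v := fun j => (line j).rep) line_cross_ne_zero Finset.univ)
      fun j _ => lin_dvd_jacobian (line_mem j)
  have hp0 : ∏ j, lin (line j).rep ≠ 0 :=
    Finset.prod_ne_zero_iff.2 fun j _ => lin_ne_zero (line j).rep_nonzero
  have hph : (∏ j, lin (line j).rep).IsHomogeneous 45 := by
    have := IsHomogeneous.prod Finset.univ (fun j => lin (line j).rep) (fun _ => 1)
      fun j _ => isHomogeneous_lin _
    simpa using this
  have hq0 : q.IsHomogeneous 0 := isHomogeneous_of_mul hph hp0 (by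
    rw [← hq]; exact isHomogeneous_jacobian)
  rw [← totalDegree_zero_iff_isHomogeneous, totalDegree_eq_zero_iff_eq_C] at hq0
  refine ⟨coeff 0 q, fun h => jacobian_ne_zero ?_, ?_⟩
  · rw [hq, hq0, h, C_0, mul_zero]
  · rw [← hq0, hq, mul_comm]

/-- The equation of any mirror is a prime factor of the Jacobian, hence proportional to one of the
45 known forms. -/
theorem wimanArrangement_eq : wimanArrangement = Set.range line := by
  refine Set.Subset.antisymm (fun ℓ hℓ => ?_) (Set.range_subset_iff.2 line_mem)
  obtain ⟨c, hc, h⟩ := exists_jacobian_eq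
  have h1 := lin_dvd_jacobian hℓ
  rw [h] at h1
  have hu : IsUnit (C c : S) := (isUnit_iff_ne_zero.2 hc).map C
  obtain ⟨j, _, hj⟩ :=
    ((prime_lin ℓ.rep_nonzero).dvd_finsetProd_iff _).1 ((hu.dvd_mul_left).1 h1)
  exact ⟨j, (eq_of_rep_cross_eq_zero (proportional_of_lin_dvd hj)).symm⟩

end Lines

/-! ### Intersection points on each mirror -/

section Points

theorem triple_vecMul (M : Matrix (Fin 3) (Fin 3) ℂ) (u v w : Fin 3 → ℂ) :
    (u ᵥ* M) ⬝ᵥ (v ᵥ* M) ⨯₃ (w ᵥ* M) = M.det * (u ⬝ᵥ v ⨯₃ w) := by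
  rw [dot_cross_eq_tri, dot_cross_eq_tri]
  simp only [tri, vecMul, dot_expand, det_fin_three]
  ring

/-- Concurrency is invariant under the group, so the points checked on the first mirror can be
transported to the others. -/
theorem triple_perm_eq_zero_iff (i : Fin 3) (a b c : Fin 45) :
    mirror (perm i a) ⬝ᵥ mirror (perm i b) ⨯₃ mirror (perm i c) = 0 ↔
      mirror a ⬝ᵥ mirror b ⨯₃ mirror c = 0 := by
  have h := triple_vecMul (gen i) (mirror a) (mirror b) (mirror c)
  have hdet : (gen i).det ≠ 0 := fun h0 => by
    have := det_gen_sq i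
    simp [h0] at this
  simp only [mirror_vecMul_gen, map_smul, LinearMap.smul_apply, smul_dotProduct, dotProduct_smul,
    smul_eq_mul] at h
  constructor
  · intro h0
    rw [h0] at h
    simpa [hdet] using h.symm
  · intro h0
    rw [h0] at h
    simpa [toC_unitK_ne_zero] using h

/-- Every mirror contains exactly 16 intersection points. -/
theorem exists_points (j : Fin 45) : ∃ P : Finset (Fin 45), P.card = 16 ∧ j ∉ P ∧
    (∀ k, k ≠ j → ∃ p ∈ P, mirror j ⬝ᵥ mirror p ⨯₃ mirror k = 0) ∧
    ∀ p ∈ P, ∀ q ∈ P, p ≠ q → mirror j ⬝ᵥ mirror p ⨯₃ mirror q ≠ 0 := by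
  have htri : ∀ a b c, mirror a ⬝ᵥ mirror b ⨯₃ mirror c = toC (tri (form a) (form b) (form c)) := by
    intro a b c
    rw [dot_cross_eq_tri, map_tri]; rfl
  induction j using WellFoundedLT.induction with
  | ind j ih =>
  by_cases hj : j = 0
  · subst hj
    refine ⟨basePoints, basePoints_card, zero_notMem_basePoints, fun k hk => ?_,
      fun p hp q hq hpq h => ?_⟩
    · obtain ⟨p, hp, h⟩ := basePoints_cover k hk
      exact ⟨p, hp, by rw [htri, h, map_zero]⟩
    · rw [htri] at h
      exact basePoints_indep p hp q hq hpq (toC_injective (h.trans (map_zero toC).symm))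
  · obtain ⟨i, k, hk, rfl⟩ := exists_perm_eq j hj
    obtain ⟨P, hcard, hP, hcover, hind⟩ := ih k hk
    have hinj : Function.Injective (perm i) := Function.Involutive.injective (perm_perm i)
    refine ⟨P.image (perm i), ?_, ?_, ?_, ?_⟩
    · rw [Finset.card_image_of_injective _ hinj, hcard]
    · rwa [hinj.mem_finset_image]
    · intro m hm
      obtain ⟨p, hp, h⟩ := hcover (perm i m) fun h => hm (by rw [← h, perm_perm])
      refine ⟨perm i p, Finset.mem_image_of_mem _ hp, ?_⟩
      rw [← triple_perm_eq_zero_iff i, perm_perm] at h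
      exact h
    · simp only [Finset.mem_image]
      rintro _ ⟨p, hp, rfl⟩ _ ⟨q, hq, rfl⟩ hpq
      rw [Ne, triple_perm_eq_zero_iff]
      exact hind p hp q hq fun h => hpq (by rw [h])

theorem triple_line_eq_zero_iff (a b c : Fin 45) :
    (line a).rep ⬝ᵥ (line b).rep ⨯₃ (line c).rep = 0 ↔
      mirror a ⬝ᵥ mirror b ⨯₃ mirror c = 0 := by
  obtain ⟨r, hr, ha⟩ := exists_rep_line a
  obtain ⟨s, hs, hb⟩ := exists_rep_line b
  obtain ⟨t, ht, hc⟩ := exists_rep_line c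
  rw [ha, hb, hc]
  simp [hr, hs, ht]

end Points

/-! ### Conclusion for the Wiman arrangement -/

theorem ncard_wimanArrangement : wimanArrangement.ncard = 45 := by
  rw [wimanArrangement_eq, ← Set.image_univ, Set.ncard_image_of_injective _ line_injective,
    Set.ncard_univ, Nat.card_eq_fintype_card, Fintype.card_fin]

theorem isPlusOneGenerated_diff (j : Fin 45) :
    IsPlusOneGenerated (wimanArrangement \ {line j}) 19 25 28 := by
  have hset : wimanArrangement \ {line j} = line '' (Finset.univ.erase j : Finset (Fin 45)) := by
    rw [wimanArrangement_eq, Finset.coe_erase, Finset.coe_univ,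
      Set.image_sdiff line_injective, Set.image_univ, Set.image_singleton]
  have hprod : (∏ᶠ ℓ ∈ wimanArrangement \ {line j}, lineForm ℓ) =
      ∏ i ∈ Finset.univ.erase j, lin (line i).rep := by
    rw [hset, finprod_mem_image line_injective.injOn, finprod_mem_coe_finset]
    rfl
  have hcard : (wimanArrangement \ {line j}).ncard = 44 := by
    rw [hset, Set.ncard_image_of_injective _ line_injective, Set.ncard_coe_finset,
      Finset.card_erase_of_mem (Finset.mem_univ _), Finset.card_univ, Fintype.card_fin]
  obtain ⟨P, hPcard, hP, hcover, hind⟩ := exists_points j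
  obtain ⟨c, hc, hsaito⟩ := exists_jacobian_eq
  refine ⟨hset ▸ (Finset.finite_toSet _).image _, ?_⟩
  rw [hprod, hcard]
  refine isPlusOneGeneratedCurve_deletion (v := fun i => (line i).rep) line_cross_ne_zero
    (fun i => (line i).rep_nonzero) j hP (fun k hk => ?_) (fun p hp q hq hpq => ?_) (by norm_num)
    (by norm_num) (by norm_num) (by simp) (by rw [hPcard]) (by rw [hPcard]; norm_num) (by norm_num)
    isHomogeneous_hessField₁ isHomogeneous_hessField₂ (fun i => (tangent_of_mem (line_mem i)).1)
    (fun i => (tangent_of_mem (line_mem i)).2) hc hsaito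
  · obtain ⟨p, hp, h⟩ := hcover k hk
    exact ⟨p, hp, (triple_line_eq_zero_iff _ _ _).2 h⟩
  · rw [Ne, triple_line_eq_zero_iff]
    exact hind p hp q hq hpq

end WimanDeletion

theorem proposition5p3 :
    WimanDeletion.wimanArrangement.ncard = 45 ∧
    ∀ ℓ ∈ WimanDeletion.wimanArrangement,
      WimanDeletion.IsPlusOneGenerated (WimanDeletion.wimanArrangement \ {ℓ}) 19 25 28 := by
  refine ⟨WimanDeletion.ncard_wimanArrangement, fun ℓ hℓ => ?_⟩
  rw [WimanDeletion.wimanArrangement_eq] at hℓ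
  obtain ⟨j, rfl⟩ := hℓ
  exact WimanDeletion.isPlusOneGenerated_diff j
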